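/- Logarithms are in base $2$. For an algebraic number $\lambda\in\overline{\mathbb Q}\subset\mathbb C$ let $\mu_\lambda^{(n)}$ be the law of the random variable $\sum_{i=0}^{n-1}\varepsilon_i\lambda^i$, where the $\varepsilon_i$ are independent and take each of the values $1$ and $-1$ with probability $1/2$. Let $H(\mu)=-\sum_x\mu(\{x\})\log\mu(\{x\})$ denote the Shannon entropy of a finitely supported probability measure $\mu$. Let $\pi_\lambda=a_r\prod_{i=1}^r(X-\lambda_i)\in\mathbb Z[X]$ be the minimal polynomial of $\lambda$ over $\mathbb Z$ (irreducible in $\mathbb Z[X]$, with $\pi_\lambda(\lambda)=0$, unique up to sign), and let $M_\lambda=|a_r|\prod_{|\lambda_i|>1}|\lambda_i|$ be its Mahler measure. There is an absolute constant $c\ge 0.44$ such that for every algebraic number $\lambda\in\mathbb C$ the limit $$h_\lambda=\lim_{n\to\infty}\frac{H(\mu_\lambda^{(n)})}{n}$$ exists and $$c\,\min\{1,\log M_\lambda\}\le h_\lambda\le\min\{1,\log M_\lambda\}.$$ -/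

import Mathlib

open Filter Topology Polynomial

noncomputable section

namespace BernoulliEntropy

/-- Shannon entropy in base `2` of a discrete probability measure: `-∑ x, p x * log₂ (p x)`.
(It is only used for laws with finite support, so that the sum is a finite one.) -/
def shannonEntropy {α : Type*} (p : PMF α) : ℝ :=
  ∑' x, -((p x).toReal * Real.logb 2 (p x).toReal)

/-- The law `μ_z^{(n)}` of the random sum `∑_{i < n} ± z ^ i`, where the signs are independent fair
coin tosses, i.e. the vector of signs is uniformly distributed on `{1, -1}ⁿ`. -/
def signedSumLaw (z : ℂ) (n : ℕ) : PMF ℂ :=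
  (PMF.uniformOfFintype (Fin n → ℤˣ)).map
    (fun ε => ∑ i : Fin n, (((ε i : ℤˣ) : ℤ) : ℂ) * z ^ (i : ℕ))

/-- The sequence `H(μ_z^{(n)}) / n`. -/
def normalizedEntropy (z : ℂ) (n : ℕ) : ℝ :=
  shannonEntropy (signedSumLaw z n) / n

/-- The entropy `h_z = lim H(μ_z^{(n)}) / n` of the random walk. -/
def entropyRate (z : ℂ) : ℝ :=
  limUnder atTop (normalizedEntropy z)

/-- The minimal polynomial in `ℤ[X]` of an algebraic number `z`: the primitive integer multiple
of the minimal polynomial of `z` over `ℚ` (unique up to sign). -/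
def intMinpoly (z : ℂ) : ℤ[X] :=
  (IsLocalization.integerNormalization (nonZeroDivisors ℤ) (minpoly ℚ z)).primPart

/-- The Mahler measure `M_z` of an algebraic number `z`: the Mahler measure of its minimal
polynomial in `ℤ[X]`. -/
def mahler (z : ℂ) : ℝ :=
  ((intMinpoly z).map (Int.castRingHom ℂ)).mahlerMeasure

/-- The defining formula `M = |a_r| ∏_{|z_i| > 1} |z_i|` for the Mahler measure. -/
theorem mahler_eq (z : ℂ) :
    mahler z = |((intMinpoly z).leadingCoeff : ℝ)| *
      ((((intMinpoly z).map (Int.castRingHom ℂ)).roots.filter (fun w => 1 < ‖w‖)).map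
        (fun w => ‖w‖)).prod := by
  have hinj : Function.Injective (Int.castRingHom ℂ) := Int.cast_injective
  have key : ∀ s : Multiset ℂ, (s.map (fun w => max 1 ‖w‖)).prod =
      ((s.filter (fun w => 1 < ‖w‖)).map (fun w => ‖w‖)).prod := by
    intro s
    induction s using Multiset.induction_on with
    | empty => simp
    | cons a s ih =>
      by_cases h : 1 < ‖a‖
      · simp [h, ih, max_eq_right h.le]
      · simp [h, ih, max_eq_left (not_lt.mp h)]
  rw [mahler, mahlerMeasure_eq_leadingCoeff_mul_prod_roots, key,
    leadingCoeff_map_of_injective hinj]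
  simp

/-- `intMinpoly z` is irreducible in `ℤ[X]` and vanishes at the algebraic number `z`. -/
theorem intMinpoly_spec {z : ℂ} (hz : IsAlgebraic ℚ z) :
    Irreducible (intMinpoly z) ∧ aeval z (intMinpoly z) = 0 := by
  set q : ℤ[X] := IsLocalization.integerNormalization (nonZeroDivisors ℤ) (minpoly ℚ z) with hq
  have hm0 : minpoly ℚ z ≠ 0 := minpoly.ne_zero hz.isIntegral
  have hq0 : q ≠ 0 := by
    rw [hq, Ne, IsFractionRing.integerNormalization_eq_zero_iff]
    exact hm0
  have hc0 : q.content ≠ 0 := by rwa [Ne, content_eq_zero_iff]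
  obtain ⟨b, hb, hbq⟩ := IsLocalization.integerNormalization_spec (nonZeroDivisors ℤ) (minpoly ℚ z)
  have hb0 : b ≠ 0 := nonZeroDivisors.ne_zero hb
  have hmap : C (q.content : ℚ) * (intMinpoly z).map (algebraMap ℤ ℚ) =
      C (b : ℚ) * minpoly ℚ z := by
    have h1 := congrArg (Polynomial.map (algebraMap ℤ ℚ)) q.eq_C_content_mul_primPart
    rw [hq, hbq, Polynomial.map_mul, map_C] at h1
    rw [← Int.cast_smul_eq_zsmul ℚ, smul_eq_C_mul] at h1
    exact h1.symm
  have hcu : IsUnit (C (q.content : ℚ)) := isUnit_C.mpr (by simpa using hc0)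
  have hbu : IsUnit (C (b : ℚ)) := isUnit_C.mpr (by simpa using hb0)
  refine ⟨?_, ?_⟩
  · rw [show intMinpoly z = q.primPart from rfl] at hmap ⊢
    rw [(isPrimitive_primPart q).irreducible_iff_irreducible_map_fraction_map (K := ℚ)]
    rw [← irreducible_isUnit_mul hcu]
    refine (congrArg Irreducible hmap).mpr ?_
    rw [irreducible_isUnit_mul hbu]
    exact minpoly.irreducible hz.isIntegral
  · have h2 := congrArg (aeval z) hmap
    rw [map_mul, map_mul, minpoly.aeval, mul_zero, aeval_map_algebraMap, aeval_C] at h2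
    refine (mul_eq_zero.mp h2).resolve_left ?_
    simpa using hc0

end BernoulliEntropy

end

/-! The limit exists by Fekete's lemma: splitting a sign vector into two blocks shows that `H` is
subadditive. The bound by `1` is the entropy of `n` fair bits. The bound by `log M` matters only for
`M < 2`. Then the integral minimal polynomial has leading coefficient `±1`, and its resultant with a
difference polynomial is an integer, equal up to sign to a product over the conjugates. Two sums
that are close at all conjugates therefore coincide (`signedSum_eq_of_prod_lt_one`), and the
pigeonhole principle leaves at most `M ^ n` values, up to a factor polynomial in `n`.

For the lower bound, if no two sign vectors ever collide, the rate is `1`. Otherwise the leading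
coefficient is again `±1`, and the conjugates outside the closed unit disc are the roots of a monic
real `P` with `|P(0)| = M`. Replace `z` by a real operator `A` with `P(A) = 0` whose inverse `B` has
`|det B| = 1 / M`. The powers of `B` decay, and a single functional `ℓ` separates points along them,
so `‖x‖² = ∑ ℓ(B^k x)²` is a Euclidean norm with `‖B x‖² = ‖x‖² - ℓ(x)²`.

Let `X = ∑ ε_i A^i v`, let `G` be a standard Gaussian vector for this norm, and let `K_j = H(ε | B^j
X + G)`. Since `K_0 ≥ H(ε | X)` and `K_n ≤ n log 2`, one gets `H(X) ≥ K_n - K_0`. In `B^j X` the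
sign `ε_j` has coefficient exactly `v`. By the chain rule, `K_j` is the entropy of the other signs
given the observation plus the entropy of `ε_j` given everything else. When `j` becomes `j + 1`, the
first term cannot drop, because `B⁻¹ G` is `G` plus independent noise in one direction. The second
is the one-dimensional function `errEnt`, which passes from `errEnt ‖v‖` to `errEnt ‖B v‖`. For `v`
parallel to the vector representing `ℓ`, `‖B v‖ = ‖v‖ / M`. Hence the rate, in nats, is at least
`errEnt (t / M) - errEnt t` for every `t ≥ 0` (`entropy_bound_of_mahler`).

It remains to choose `t`. Since `errEnt' s = - s * mmse s`, one needs a window of ratio `M` on which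
`s * mmse s - 0.44 / s` has nonnegative integral. For `M ≤ 2` it is found inside `[0.84, 1.68]` by a
quadrature certified in natural number arithmetic; for `M ≥ 2` monotonicity of `errEnt` reduces to
`M = 2`. -/

noncomputable section

namespace BernoulliEntropy

/-! ### Entropy of an image of the uniform law through fibre sizes -/

/-- The number of points in the fibre of `f` through `a`. -/
def fiberCard {α β : Type*} [Fintype α] (f : α → β) (a : α) : ℕ :=
  Nat.card {a' // f a' = f a}

theorem fiberCard_eq {α β : Type*} [Fintype α] [DecidableEq β] (f : α → β) (a : α) :
    fiberCard f a = (Finset.univ.filter (fun a' => f a' = f a)).card := by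
  rw [fiberCard, Nat.card_eq_fintype_card, Fintype.card_subtype]

theorem fiberCard_pos {α β : Type*} [Fintype α] (f : α → β) (a : α) : 0 < fiberCard f a := by
  classical
  rw [fiberCard_eq]
  exact Finset.card_pos.mpr ⟨a, by simp⟩

theorem fiberCard_le {α β : Type*} [Fintype α] (f : α → β) (a : α) :
    fiberCard f a ≤ Fintype.card α := by
  classical
  rw [fiberCard_eq]
  exact Finset.card_le_univ _

theorem fiberCard_le_of_imp {α β γ : Type*} [Fintype α] {f : α → β} {g : α → γ}
    (h : ∀ a a', f a = f a' → g a = g a') (a : α) : fiberCard f a ≤ fiberCard g a := by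
  classical
  rw [fiberCard_eq, fiberCard_eq]
  exact Finset.card_le_card fun x hx => by
    simp only [Finset.mem_filter, Finset.mem_univ, true_and] at hx ⊢
    exact h _ _ hx

/-- The entropy of the law of `f` under the uniform measure, in terms of the sizes of the fibres. -/
theorem shannonEntropy_map_uniform {α β : Type*} [Fintype α] [Nonempty α] (f : α → β) :
    shannonEntropy ((PMF.uniformOfFintype α).map f) =
      Real.logb 2 (Fintype.card α) -
        (∑ a, Real.logb 2 (fiberCard f a)) / Fintype.card α := by
  have : DecidableEq β := Classical.decEq β
  set p := (PMF.uniformOfFintype α).map f with hp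
  have hα : (Fintype.card α : ℝ) ≠ 0 := by exact_mod_cast Fintype.card_ne_zero
  have hpx : ∀ x, (p x).toReal =
      (Finset.univ.filter (fun a => f a = x)).card / (Fintype.card α : ℝ) := by
    intro x
    have h0 : p x = ∑ b, if f b = x then PMF.uniformOfFintype α b else 0 := by
      rw [hp, PMF.map_apply, tsum_fintype]
      exact Finset.sum_congr rfl fun b _ => by
        by_cases h : x = f b
        · simp [h]
        · simp [h, Ne.symm h]
    rw [h0, ← Finset.sum_filter]
    simp only [PMF.uniformOfFintype_apply, Finset.sum_const, nsmul_eq_mul]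
    rw [ENNReal.toReal_mul, ENNReal.toReal_inv]
    simp only [ENNReal.toReal_natCast]
    rfl
  rw [shannonEntropy, tsum_eq_sum (s := Finset.univ.image f)]
  · have key : ∀ x ∈ Finset.univ.image f,
        -((p x).toReal * Real.logb 2 (p x).toReal) =
        (Finset.univ.filter (fun a => f a = x)).card •
          (fun x => (Real.logb 2 (Fintype.card α) -
            Real.logb 2 (Finset.univ.filter (fun a => f a = x)).card) / Fintype.card α) x := by
      intro x hx
      obtain ⟨a, -, rfl⟩ := Finset.mem_image.mp hx
      beta_reduce
      rw [hpx, ← fiberCard_eq, nsmul_eq_mul,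
        Real.logb_div (by exact_mod_cast (fiberCard_pos f a).ne') hα]
      ring
    rw [Finset.sum_congr rfl key, ← Finset.sum_comp]
    simp only [← fiberCard_eq]
    rw [← Finset.sum_div, Finset.sum_sub_distrib, Finset.sum_const, nsmul_eq_mul, sub_div,
      Finset.card_univ, mul_div_cancel_left₀ _ hα]
  · intro x hx
    have : Finset.univ.filter (fun a => f a = x) = ∅ := by
      rw [Finset.filter_eq_empty_iff]
      intro a _ h
      exact hx (Finset.mem_image.mpr ⟨a, Finset.mem_univ _, h⟩)
    rw [hpx, this]
    simp

theorem shannonEntropy_map_uniform_nonneg {α β : Type*} [Fintype α] [Nonempty α] (f : α → β) :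
    0 ≤ shannonEntropy ((PMF.uniformOfFintype α).map f) := by
  have hα : (0 : ℝ) < Fintype.card α := by exact_mod_cast Fintype.card_pos
  rw [shannonEntropy_map_uniform, sub_nonneg, div_le_iff₀ hα]
  calc ∑ a, Real.logb 2 (fiberCard f a) ≤ ∑ _a : α, Real.logb 2 (Fintype.card α) := by
        refine Finset.sum_le_sum fun a _ => ?_
        exact Real.logb_le_logb_of_le (by norm_num) (by exact_mod_cast fiberCard_pos f a)
          (by exact_mod_cast fiberCard_le f a)
    _ = _ := by rw [Finset.sum_const, nsmul_eq_mul, Finset.card_univ, mul_comm]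

theorem sum_logb_fiberCard_nonneg {α β : Type*} [Fintype α] (f : α → β) :
    0 ≤ ∑ a, Real.logb 2 (fiberCard f a) :=
  Finset.sum_nonneg fun a _ => Real.logb_nonneg (by norm_num)
    (by exact_mod_cast fiberCard_pos f a)

theorem shannonEntropy_map_uniform_le {α β : Type*} [Fintype α] [Nonempty α] (f : α → β) :
    shannonEntropy ((PMF.uniformOfFintype α).map f) ≤ Real.logb 2 (Fintype.card α) := by
  rw [shannonEntropy_map_uniform]
  have := sum_logb_fiberCard_nonneg f
  have : 0 ≤ (∑ a, Real.logb 2 (fiberCard f a)) / Fintype.card α := by positivity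
  linarith

theorem shannonEntropy_map_uniform_of_injective {α β : Type*} [Fintype α] [Nonempty α] {f : α → β}
    (hf : Function.Injective f) :
    shannonEntropy ((PMF.uniformOfFintype α).map f) = Real.logb 2 (Fintype.card α) := by
  rw [shannonEntropy_map_uniform]
  have : ∀ a, fiberCard f a = 1 := fun a => by
    rw [fiberCard, Nat.card_eq_one_iff_unique]
    exact ⟨⟨fun x y => Subtype.ext (hf (x.2.trans y.2.symm))⟩, ⟨⟨a, rfl⟩⟩⟩
  simp [this]

/-- The entropy of a law supported on `m` points is at most `log m`. -/
theorem shannonEntropy_map_uniform_le_of_card_image_le {α β : Type*} [Fintype α] [Nonempty α]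
    [DecidableEq β] (f : α → β) {m : ℝ} (hm : ((Finset.univ.image f).card : ℝ) ≤ m) :
    shannonEntropy ((PMF.uniformOfFintype α).map f) ≤ Real.logb 2 m := by
  have hα : (0 : ℝ) < Fintype.card α := by exact_mod_cast Fintype.card_pos
  have hfib : ∀ a, (0 : ℝ) < fiberCard f a := fun a => by exact_mod_cast fiberCard_pos f a
  have hi : (0 : ℝ) < (Finset.univ.image f).card := by
    exact_mod_cast Finset.card_pos.mpr (Finset.univ_nonempty.image f)
  have hm0 : 0 < m := hi.trans_le hm
  -- Each attained value is counted once: its fibre has `fiberCard` points, each of weight the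
  -- reciprocal.
  have h1 : ∑ a, (1 / (fiberCard f a : ℝ)) = (Finset.univ.image f).card := by
    simp only [fiberCard_eq]
    refine (Finset.sum_comp (s := Finset.univ)
      (fun x => 1 / ((Finset.univ.filter (fun a' => f a' = x)).card : ℝ)) f).trans ?_
    rw [Finset.cast_card]
    refine Finset.sum_congr rfl fun x hx => ?_
    obtain ⟨a, -, rfl⟩ := Finset.mem_image.mp hx
    have := hfib a
    rw [fiberCard_eq] at this
    rw [nsmul_eq_mul, mul_one_div, div_self]
    exact_mod_cast this.ne'
  -- Gibbs' inequality against the uniform law on `m` points, in the form `log x ≤ x - 1`.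
  have h2 : ∀ a, Real.log (Fintype.card α) - Real.log (fiberCard f a) - Real.log m ≤
      Fintype.card α / m * (1 / (fiberCard f a : ℝ)) - 1 := by
    intro a
    have := Real.log_le_sub_one_of_pos
      (show 0 < Fintype.card α / m * (1 / (fiberCard f a : ℝ)) by have := hfib a; positivity)
    rw [Real.log_mul (by positivity) (by have := hfib a; positivity),
      Real.log_div hα.ne' hm0.ne', one_div, Real.log_inv] at this
    rw [one_div]
    linarith
  have h3 := Finset.sum_le_sum fun a (_ : a ∈ Finset.univ) => h2 a
  rw [Finset.sum_sub_distrib, Finset.sum_sub_distrib, Finset.sum_sub_distrib, ← Finset.mul_sum, h1]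
    at h3
  simp only [Finset.sum_const, nsmul_eq_mul, Finset.card_univ, mul_one] at h3
  have h4 : (Fintype.card α : ℝ) / m * (Finset.univ.image f).card ≤ Fintype.card α := by
    rw [div_mul_eq_mul_div, div_le_iff₀ hm0]
    gcongr
  have h5 : (Fintype.card α : ℝ) * Real.log (Fintype.card α) - ∑ a, Real.log (fiberCard f a) ≤
      Fintype.card α * Real.log m := by linarith
  rw [shannonEntropy_map_uniform]
  simp only [Real.logb, ← Finset.sum_div]
  have hl : 0 < Real.log 2 := Real.log_pos (by norm_num)
  rw [div_right_comm, ← sub_div]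
  refine (div_le_div_iff_of_pos_right hl).mpr ?_
  rw [sub_le_iff_le_add, ← sub_le_iff_le_add', le_div_iff₀ hα]
  linarith

/-! ### Signed sums, subadditivity and the entropy rate -/

/-- The sum `∑ s_i z ^ i`. -/
def signedSum (z : ℂ) (n : ℕ) (s : Fin n → ℤˣ) : ℂ :=
  ∑ i : Fin n, (((s i : ℤˣ) : ℤ) : ℂ) * z ^ (i : ℕ)

theorem signedSumLaw_eq (z : ℂ) (n : ℕ) :
    signedSumLaw z n = (PMF.uniformOfFintype (Fin n → ℤˣ)).map (signedSum z n) := rfl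

theorem card_signs (n : ℕ) : Fintype.card (Fin n → ℤˣ) = 2 ^ n := by
  simp

theorem logb_card_signs (n : ℕ) : Real.logb 2 (Fintype.card (Fin n → ℤˣ)) = n := by
  rw [card_signs]
  simp [Real.logb_pow]

theorem signedSum_append (z : ℂ) (m n : ℕ) (s : Fin m → ℤˣ) (t : Fin n → ℤˣ) :
    signedSum z (m + n) (Fin.append s t) = signedSum z m s + z ^ m * signedSum z n t := by
  simp only [signedSum, Fin.sum_univ_add, Fin.append_left, Fin.append_right, Fin.val_castAdd,
    Fin.val_natAdd, Finset.mul_sum, pow_add]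
  congr 1
  exact Finset.sum_congr rfl fun i _ => by ring

/-- Collisions concatenate: replacing each block by one with the same sum preserves the total. After
taking logarithms and averaging, this is the subadditivity of the entropy. -/
theorem fiberCard_mul_le (z : ℂ) (m n : ℕ) (s : Fin m → ℤˣ) (t : Fin n → ℤˣ) :
    fiberCard (signedSum z m) s * fiberCard (signedSum z n) t ≤
      fiberCard (signedSum z (m + n)) (Fin.append s t) := by
  rw [fiberCard, fiberCard, fiberCard, ← Nat.card_prod]
  refine Nat.card_le_card_of_injective
    (fun p => ⟨Fin.append p.1.1 p.2.1, by
      rw [signedSum_append, signedSum_append, p.1.2, p.2.2]⟩) ?_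
  rintro ⟨⟨a, ha⟩, ⟨b, hb⟩⟩ ⟨⟨a', ha'⟩, ⟨b', hb'⟩⟩ h
  have h' := (Fin.appendEquiv m n).injective (a₁ := (a, b)) (a₂ := (a', b'))
    (congrArg Subtype.val h)
  simp only [Prod.mk.injEq] at h'
  obtain ⟨rfl, rfl⟩ := h'
  rfl

theorem subadditive_shannonEntropy (z : ℂ) :
    Subadditive fun n => shannonEntropy (signedSumLaw z n) := by
  intro m n
  simp only [signedSumLaw_eq, shannonEntropy_map_uniform, card_signs]
  have h : (2 : ℝ) ^ n * ∑ s, Real.logb 2 (fiberCard (signedSum z m) s) +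
      2 ^ m * ∑ t, Real.logb 2 (fiberCard (signedSum z n) t) ≤
      ∑ a, Real.logb 2 (fiberCard (signedSum z (m + n)) a) := by
    rw [← (Fin.appendEquiv m n).sum_comp, Fintype.sum_prod_type]
    calc _ = ∑ s, ∑ t, (Real.logb 2 (fiberCard (signedSum z m) s) +
        Real.logb 2 (fiberCard (signedSum z n) t)) := by
          simp only [Finset.sum_add_distrib, Finset.sum_const, Finset.card_univ, card_signs,
            nsmul_eq_mul, Finset.mul_sum]
          push_cast
          rfl
      _ ≤ _ := by
          refine Finset.sum_le_sum fun s _ => Finset.sum_le_sum fun t _ => ?_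
          have h1 : (0 : ℝ) < fiberCard (signedSum z m) s := by exact_mod_cast fiberCard_pos _ _
          have h2 : (0 : ℝ) < fiberCard (signedSum z n) t := by exact_mod_cast fiberCard_pos _ _
          rw [← Real.logb_mul h1.ne' h2.ne']
          refine Real.logb_le_logb_of_le (by norm_num) (by positivity) ?_
          exact_mod_cast fiberCard_mul_le z m n s t
  push_cast
  have h2 : (∑ s, Real.logb 2 (fiberCard (signedSum z m) s)) / 2 ^ m +
      (∑ t, Real.logb 2 (fiberCard (signedSum z n) t)) / 2 ^ n ≤
      (∑ a, Real.logb 2 (fiberCard (signedSum z (m + n)) a)) / 2 ^ (m + n) := by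
    rw [div_add_div _ _ (by positivity) (by positivity), ← pow_add]
    gcongr
    linarith
  rw [pow_add, Real.logb_mul (by positivity) (by positivity), ← pow_add]
  linarith

theorem tendsto_normalizedEntropy (z : ℂ) :
    Tendsto (normalizedEntropy z) atTop (𝓝 (entropyRate z)) := by
  have := (subadditive_shannonEntropy z).tendsto_lim ⟨0, by
    rintro _ ⟨n, rfl⟩
    have := shannonEntropy_map_uniform_nonneg (signedSum z n)
    rw [← signedSumLaw_eq] at this
    positivity⟩
  have h2 : Tendsto (normalizedEntropy z) atTop (𝓝 (subadditive_shannonEntropy z).lim) := this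
  rw [entropyRate, h2.limUnder_eq]
  exact h2

theorem entropyRate_nonneg (z : ℂ) : 0 ≤ entropyRate z :=
  ge_of_tendsto' (tendsto_normalizedEntropy z) fun n => by
    have := shannonEntropy_map_uniform_nonneg (signedSum z n)
    rw [← signedSumLaw_eq] at this
    rw [normalizedEntropy]
    positivity

theorem entropyRate_le_one (z : ℂ) : entropyRate z ≤ 1 :=
  le_of_tendsto' (tendsto_normalizedEntropy z) fun n => by
    have := shannonEntropy_map_uniform_le (signedSum z n)
    rw [← signedSumLaw_eq, logb_card_signs] at this
    exact div_le_one_of_le₀ this (by positivity)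

theorem entropyRate_eq_one {z : ℂ} (hz : ∀ n, Function.Injective (signedSum z n)) :
    entropyRate z = 1 := by
  refine tendsto_nhds_unique (tendsto_normalizedEntropy z) ?_
  refine tendsto_const_nhds.congr' ?_
  filter_upwards [eventually_gt_atTop 0] with n hn
  rw [normalizedEntropy, signedSumLaw_eq, shannonEntropy_map_uniform_of_injective (hz n),
    logb_card_signs, div_self (by exact_mod_cast hn.ne')]

/-- A linear lower bound for the entropy of `n` steps bounds the entropy rate. -/
theorem le_entropyRate {z : ℂ} {a : ℝ}
    (h : ∀ n : ℕ, a * n * 2 ^ n ≤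
      n * 2 ^ n * Real.log 2 - ∑ s, Real.log (fiberCard (signedSum z n) s)) :
    a / Real.log 2 ≤ entropyRate z := by
  refine ge_of_tendsto (tendsto_normalizedEntropy z) ?_
  filter_upwards [eventually_gt_atTop 0] with n hn
  have hl : 0 < Real.log 2 := Real.log_pos (by norm_num)
  have hn' : (0 : ℝ) < n := by exact_mod_cast hn
  rw [normalizedEntropy, signedSumLaw_eq, shannonEntropy_map_uniform, logb_card_signs, card_signs,
    le_div_iff₀ hn']
  simp only [Real.logb, ← Finset.sum_div]
  push_cast
  have h2 : (0 : ℝ) < 2 ^ n := by positivity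
  rw [le_sub_iff_add_le, div_mul_eq_mul_div, div_right_comm, ← add_div, div_le_iff₀ hl,
    ← le_sub_iff_add_le', div_le_iff₀ h2]
  linarith [h n]

/-! ### Collisions as divisibility by the minimal polynomial -/

theorem intMinpoly_isPrimitive (z : ℂ) : (intMinpoly z).IsPrimitive :=
  isPrimitive_primPart _

/-- Gauss's lemma: divisibility over `ℚ` by a primitive polynomial descends to `ℤ`. -/
theorem intMinpoly_dvd {z : ℂ} (hz : IsAlgebraic ℚ z) {D : ℤ[X]} (hD : aeval z D = 0) :
    intMinpoly z ∣ D := by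
  obtain ⟨hirr, hroot⟩ := intMinpoly_spec hz
  have hprim := intMinpoly_isPrimitive z
  have hirr' := (hprim.irreducible_iff_irreducible_map_fraction_map (K := ℚ)).mp hirr
  have haev : ∀ P : ℤ[X], aeval z P = 0 → minpoly ℚ z ∣ P.map (algebraMap ℤ ℚ) := fun P hP =>
    minpoly.dvd ℚ z (by rwa [aeval_map_algebraMap])
  have hass : Associated (minpoly ℚ z) ((intMinpoly z).map (algebraMap ℤ ℚ)) :=
    (minpoly.irreducible hz.isIntegral).associated_of_dvd hirr' (haev _ hroot)
  have h2 : (intMinpoly z).map (algebraMap ℤ ℚ) ∣ D.map (algebraMap ℤ ℚ) :=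
    hass.symm.dvd.trans (haev _ hD)
  exact (IsPrimitive.dvd_iff_fraction_map_dvd_fraction_map ℚ hprim).mpr h2

/-- The integer polynomial of degree less than `n` whose coefficients are half the differences of
two sign vectors. -/
def halfDiff {n : ℕ} (s t : Fin n → ℤˣ) : ℤ[X] :=
  ∑ i : Fin n, C (if s i = t i then 0 else ((s i : ℤˣ) : ℤ)) * X ^ (i : ℕ)

theorem coeff_halfDiff {n : ℕ} (s t : Fin n → ℤˣ) (k : ℕ) : (halfDiff s t).coeff k =
    if h : k < n then (if s ⟨k, h⟩ = t ⟨k, h⟩ then 0 else ((s ⟨k, h⟩ : ℤˣ) : ℤ)) else 0 := by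
  simp only [halfDiff, finsetSum_coeff, coeff_C_mul, coeff_X_pow]
  split_ifs with h h2
  · refine Finset.sum_eq_zero fun i _ => ?_
    by_cases hk : k = i
    · subst hk; simp [h2]
    · simp [hk]
  · rw [Finset.sum_eq_single ⟨k, h⟩]
    · simp [h2]
    · intro i _ hi
      have : k ≠ i := fun hk => hi (Fin.ext hk.symm)
      simp [this]
    · simp
  · refine Finset.sum_eq_zero fun i _ => ?_
    have : k ≠ i := fun hk => h (hk ▸ i.2)
    simp [this]

theorem halfDiff_ne_zero {n : ℕ} {s t : Fin n → ℤˣ} (h : s ≠ t) : halfDiff s t ≠ 0 := by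
  obtain ⟨i, hi⟩ := Function.ne_iff.mp h
  intro h0
  have := congrArg (fun P => P.coeff i) h0
  simp [coeff_halfDiff, hi] at this

theorem isUnit_leadingCoeff_halfDiff {n : ℕ} {s t : Fin n → ℤˣ} (h : s ≠ t) :
    IsUnit (halfDiff s t).leadingCoeff := by
  have h0 : (halfDiff s t).leadingCoeff ≠ 0 := leadingCoeff_ne_zero.mpr (halfDiff_ne_zero h)
  rw [leadingCoeff, coeff_halfDiff] at h0 ⊢
  split_ifs at h0 ⊢ with h1 h2
  · exact (h0 rfl).elim
  · exact Units.isUnit _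
  · exact (h0 rfl).elim

/-- Stated over any ring because it is evaluated both at complex numbers and at endomorphisms of a
real vector space. -/
theorem two_mul_aeval_halfDiff {A : Type*} [Ring A] {n : ℕ} (s t : Fin n → ℤˣ) (a : A) :
    2 * aeval a (halfDiff s t) = ∑ i : Fin n, (((s i : ℤˣ) : ℤ) : A) * a ^ (i : ℕ) -
      ∑ i : Fin n, (((t i : ℤˣ) : ℤ) : A) * a ^ (i : ℕ) := by
  rw [halfDiff, map_sum, Finset.mul_sum, ← Finset.sum_sub_distrib]
  refine Finset.sum_congr rfl fun i _ => ?_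
  rw [map_mul, aeval_C, map_pow, aeval_X, eq_intCast]
  by_cases h : s i = t i
  · simp [h]
  · have h2 : t i = -s i := by
      rcases Int.units_eq_one_or (s i) with h1 | h1 <;> rcases Int.units_eq_one_or (t i) with h2 | h2
      · exact (h (h1.trans h2.symm)).elim
      · rw [h1, h2]
      · rw [h1, h2]; rfl
      · exact (h (h1.trans h2.symm)).elim
    rw [if_neg h, h2, Units.val_neg, Int.cast_neg, two_mul, neg_mul, sub_neg_eq_add]

theorem signedSum_sub (z : ℂ) {n : ℕ} (s t : Fin n → ℤˣ) :
    signedSum z n s - signedSum z n t = 2 * aeval z (halfDiff s t) :=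
  (two_mul_aeval_halfDiff s t z).symm

theorem intMinpoly_dvd_halfDiff {z : ℂ} (hz : IsAlgebraic ℚ z) {n : ℕ} {s t : Fin n → ℤˣ}
    (h : signedSum z n s = signedSum z n t) : intMinpoly z ∣ halfDiff s t := by
  refine intMinpoly_dvd hz ?_
  have := signedSum_sub z s t
  rw [h, sub_self] at this
  simpa using this.symm

/-- A collision yields a multiple of the minimal polynomial with coefficients in `{0, 1, -1}`. Its
leading coefficient is a unit, hence so is that of every factor. Thus a nontrivial lower bound is
only needed when the leading coefficient is `±1`. -/
theorem isUnit_leadingCoeff_of_not_injective {z : ℂ} (hz : IsAlgebraic ℚ z) {n : ℕ}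
    (h : ¬ Function.Injective (signedSum z n)) : IsUnit (intMinpoly z).leadingCoeff := by
  simp only [Function.Injective, not_forall] at h
  obtain ⟨s, t, hst, hne⟩ := h
  obtain ⟨Q, hQ⟩ := intMinpoly_dvd_halfDiff hz hst
  refine isUnit_of_dvd_unit ?_ (isUnit_leadingCoeff_halfDiff hne)
  rw [hQ, leadingCoeff_mul]
  exact dvd_mul_right _ _

theorem abs_leadingCoeff_le_mahler (z : ℂ) : |((intMinpoly z).leadingCoeff : ℝ)| ≤ mahler z := by
  have := leadingCoeff_le_mahlerMeasure ((intMinpoly z).map (Int.castRingHom ℂ))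
  rw [leadingCoeff_map_of_injective Int.cast_injective] at this
  rw [mahler]
  simpa using this

theorem intMinpoly_ne_zero {z : ℂ} (hz : IsAlgebraic ℚ z) : intMinpoly z ≠ 0 :=
  (intMinpoly_spec hz).1.ne_zero

theorem one_le_abs_leadingCoeff {z : ℂ} (hz : IsAlgebraic ℚ z) :
    1 ≤ |((intMinpoly z).leadingCoeff : ℝ)| := by
  have : (intMinpoly z).leadingCoeff ≠ 0 := leadingCoeff_ne_zero.mpr (intMinpoly_ne_zero hz)
  exact_mod_cast Int.one_le_abs this

theorem one_le_mahler {z : ℂ} (hz : IsAlgebraic ℚ z) : 1 ≤ mahler z :=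
  (one_le_abs_leadingCoeff hz).trans (abs_leadingCoeff_le_mahler z)

theorem isUnit_leadingCoeff_of_mahler_lt_two {z : ℂ} (hz : IsAlgebraic ℚ z)
    (h : mahler z < 2) : IsUnit (intMinpoly z).leadingCoeff := by
  have h1 := one_le_abs_leadingCoeff hz
  have h2 := (abs_leadingCoeff_le_mahler z).trans_lt h
  rw [Int.isUnit_iff_abs_eq]
  have h3 : |(intMinpoly z).leadingCoeff| < 2 := by exact_mod_cast h2
  have h4 : 1 ≤ |(intMinpoly z).leadingCoeff| := by exact_mod_cast h1
  omega

/-! ### Conjugates, resultants and the upper bound by pigeonhole -/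

/-- The complex roots of the integral minimal polynomial, i.e. the conjugates. -/
def conjRoots (z : ℂ) : Multiset ℂ := ((intMinpoly z).map (Int.castRingHom ℂ)).roots

theorem mahler_eq_prod_conjRoots {z : ℂ} (hu : IsUnit (intMinpoly z).leadingCoeff) :
    mahler z = ((conjRoots z).map fun w => max 1 ‖w‖).prod := by
  rw [mahler, mahlerMeasure_eq_leadingCoeff_mul_prod_roots,
    leadingCoeff_map_of_injective Int.cast_injective]
  rw [Int.isUnit_iff] at hu
  rcases hu with h | h <;> simp [h, conjRoots]

theorem mem_conjRoots {z : ℂ} (hz : IsAlgebraic ℚ z) {w : ℂ} :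
    w ∈ conjRoots z ↔ aeval w (intMinpoly z) = 0 := by
  have h0 : (intMinpoly z).map (Int.castRingHom ℂ) ≠ 0 :=
    (Polynomial.map_ne_zero_iff Int.cast_injective).mpr (intMinpoly_ne_zero hz)
  rw [conjRoots, mem_roots h0, IsRoot.def, eval_map, aeval_def]
  rfl

theorem card_conjRoots (z : ℂ) : (conjRoots z).card = (intMinpoly z).natDegree := by
  rw [conjRoots, ← (IsAlgClosed.splits _).natDegree_eq_card_roots,
    natDegree_map_eq_of_injective Int.cast_injective]

theorem map_conj_conjRoots (z : ℂ) : (conjRoots z).map (starRingEnd ℂ) = conjRoots z := by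
  rw [conjRoots, ← (IsAlgClosed.splits _).roots_map, Polynomial.map_map]
  congr 2
  exact Subsingleton.elim _ _

theorem conj_mem_conjRoots {z w : ℂ} (h : w ∈ conjRoots z) : starRingEnd ℂ w ∈ conjRoots z := by
  rw [← map_conj_conjRoots]
  exact Multiset.mem_map_of_mem _ h

theorem signedSum_conj (w : ℂ) (n : ℕ) (s : Fin n → ℤˣ) :
    signedSum (starRingEnd ℂ w) n s = starRingEnd ℂ (signedSum w n s) := by
  simp [signedSum]

theorem norm_signedSum_le (w : ℂ) (n : ℕ) (s : Fin n → ℤˣ) :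
    ‖signedSum w n s‖ ≤ n * max 1 ‖w‖ ^ n := by
  refine (norm_sum_le _ _).trans ?_
  calc _ ≤ ∑ _i : Fin n, max 1 ‖w‖ ^ n := by
        refine Finset.sum_le_sum fun i _ => ?_
        rw [norm_mul, norm_pow]
        have h1 : ‖(((s i : ℤˣ) : ℤ) : ℂ)‖ = 1 := by
          rcases Int.units_eq_one_or (s i) with h | h <;> simp [h]
        rw [h1, one_mul]
        exact (pow_le_pow_left₀ (norm_nonneg _) (le_max_right _ _) _).trans
          (pow_le_pow_right₀ (le_max_left _ _) i.2.le)
    _ = _ := by simp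

/-- If the values of `halfDiff s t` at the conjugates have product of modulus less than one,
then the two signed sums coincide. -/
theorem signedSum_eq_of_prod_lt_one {z : ℂ} (hz : IsAlgebraic ℚ z)
    (hu : IsUnit (intMinpoly z).leadingCoeff) {n : ℕ} {s t : Fin n → ℤˣ}
    (h : ((conjRoots z).map fun w => ‖aeval w (halfDiff s t)‖).prod < 1) :
    signedSum z n s = signedSum z n t := by
  set P := halfDiff s t
  set r := resultant (intMinpoly z) P with hr
  have hrC : (r : ℂ) = ((intMinpoly z).leadingCoeff : ℂ) ^ P.natDegree *
      ((conjRoots z).map fun w => aeval w P).prod := by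
    have h1 := resultant_map_map (intMinpoly z) P (intMinpoly z).natDegree P.natDegree
      (Int.castRingHom ℂ)
    have h2 := resultant_eq_prod_eval ((intMinpoly z).map (Int.castRingHom ℂ))
      (P.map (Int.castRingHom ℂ)) P.natDegree natDegree_map_le (IsAlgClosed.splits _)
    rw [natDegree_map_eq_of_injective Int.cast_injective, h1,
      leadingCoeff_map_of_injective Int.cast_injective] at h2
    simp only [eq_intCast] at h2
    rw [hr, h2, conjRoots]
    congr 3
    ext w
    rw [eval_map, aeval_def]
    rfl
  -- An integer of modulus less than one vanishes; here the modulus of the resultant is the product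
  -- over the conjugates.
  have hr0 : r = 0 := by
    by_contra hne
    have h1 : (1 : ℝ) ≤ ‖(r : ℂ)‖ := by
      rw [Complex.norm_intCast]
      exact_mod_cast Int.one_le_abs hne
    have h2 : ‖((intMinpoly z).leadingCoeff : ℂ)‖ = 1 := by
      rw [Int.isUnit_iff] at hu
      rcases hu with h | h <;> simp [h]
    rw [hrC, norm_mul, norm_pow, h2, one_pow, one_mul] at h1
    have h3 : ‖((conjRoots z).map fun w => aeval w P).prod‖ =
        ((conjRoots z).map fun w => ‖aeval w P‖).prod := by
      rw [← coe_nnnorm, ← nnnormHom_apply, map_multiset_prod, Multiset.map_map]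
      rw [← NNReal.coe_toRealHom, map_multiset_prod, Multiset.map_map]
      rfl
    linarith
  rw [hr0] at hrC
  have hprod : ((conjRoots z).map fun w => aeval w P).prod = 0 := by
    have : ((intMinpoly z).leadingCoeff : ℂ) ≠ 0 := by
      exact_mod_cast leadingCoeff_ne_zero.mpr (intMinpoly_ne_zero hz)
    simpa [this] using hrC.symm
  rw [Multiset.prod_eq_zero_iff, Multiset.mem_map] at hprod
  obtain ⟨w, hw, hw0⟩ := hprod
  rw [mem_conjRoots hz] at hw
  -- the minimal polynomial of `w` is that of `z`
  have hwalg : IsAlgebraic ℚ w := by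
    refine ⟨(intMinpoly z).map (algebraMap ℤ ℚ), ?_, by rwa [aeval_map_algebraMap]⟩
    exact (Polynomial.map_ne_zero_iff (algebraMap ℤ ℚ).injective_int).mpr (intMinpoly_ne_zero hz)
  have hassoc : Associated (intMinpoly w) (intMinpoly z) :=
    (intMinpoly_spec hwalg).1.associated_of_dvd (intMinpoly_spec hz).1 (intMinpoly_dvd hwalg hw)
  have hdvd : intMinpoly z ∣ P := hassoc.symm.dvd.trans (intMinpoly_dvd hwalg hw0)
  obtain ⟨Q, hQ⟩ := hdvd
  have := signedSum_sub z s t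
  rw [show halfDiff s t = P from rfl, hQ, map_mul, (intMinpoly_spec hz).2, zero_mul, mul_zero]
    at this
  exact sub_eq_zero.mp this

/-- A real coordinate of a complex number attached to the place `w`: the real part if `w` is in
the closed upper half plane and the imaginary part otherwise. -/
def placeCoord (w x : ℂ) : ℝ := if 0 ≤ w.im then x.re else x.im

theorem abs_placeCoord_le (w x : ℂ) : |placeCoord w x| ≤ ‖x‖ := by
  rw [placeCoord]
  split_ifs
  · exact Complex.abs_re_le_norm x
  · exact Complex.abs_im_le_norm x

/-- If the coordinates of `f w` and `f (conj w)` at the places `w` and `conj w` are small, so is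
`f w`, when `f` commutes with complex conjugation. -/
theorem norm_le_of_placeCoord {f : ℂ → ℂ}
    (hf : ∀ w, f (starRingEnd ℂ w) = starRingEnd ℂ (f w)) {w : ℂ} {δ : ℝ}
    (h1 : |placeCoord w (f w)| ≤ δ)
    (h2 : |placeCoord (starRingEnd ℂ w) (f (starRingEnd ℂ w))| ≤ δ) : ‖f w‖ ≤ 2 * δ := by
  have hδ : 0 ≤ δ := (abs_nonneg _).trans h1
  refine (Complex.norm_le_abs_re_add_abs_im _).trans ?_
  rw [hf] at h2
  simp only [placeCoord, Complex.conj_im, Complex.conj_re, Left.nonneg_neg_iff] at h1 h2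
  rcases lt_trichotomy w.im 0 with h | h | h
  · rw [if_neg h.not_ge] at h1
    rw [if_pos h.le] at h2
    linarith
  · have him : (f w).im = 0 := by
      have hw : starRingEnd ℂ w = w := Complex.conj_eq_iff_im.mpr h
      have := hf w
      rw [hw] at this
      exact Complex.conj_eq_iff_im.mp this.symm
    rw [if_pos h.ge] at h1
    rw [him, abs_zero]
    linarith
  · rw [if_pos h.le] at h1
    rw [if_neg h.not_ge, abs_neg] at h2
    linarith

theorem placeCoord_sub (w x y : ℂ) : placeCoord w (x - y) = placeCoord w x - placeCoord w y := by
  unfold placeCoord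
  split_ifs <;> simp

/-- Pigeonhole principle: the number of different values of the signed sums. -/
theorem card_image_signedSum_le {z : ℂ} (hz : IsAlgebraic ℚ z)
    (hu : IsUnit (intMinpoly z).leadingCoeff) {n k : ℕ} (hn : 0 < n)
    (hk : (2 * n : ℝ) ^ (intMinpoly z).natDegree * mahler z ^ n <
      (k : ℝ) ^ (intMinpoly z).natDegree) :
    (Finset.univ.image (signedSum z n)).card ≤ (2 * k + 1) ^ (intMinpoly z).natDegree := by
  classical
  set r := (intMinpoly z).natDegree with hr
  have hM : 1 ≤ mahler z := one_le_mahler hz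
  have hn' : (1 : ℝ) ≤ n := by exact_mod_cast hn
  have hr0 : r ≠ 0 := by
    rw [hr, ← card_conjRoots]
    intro h
    have : z ∈ conjRoots z := (mem_conjRoots hz).mpr (intMinpoly_spec hz).2
    rw [Multiset.card_eq_zero.mp h] at this
    exact absurd this (Multiset.notMem_zero _)
  have hk0 : (0 : ℝ) < k := by
    rcases Nat.eq_zero_or_pos k with h | h
    · rw [h, Nat.cast_zero, zero_pow hr0] at hk
      have : 0 ≤ (2 * n : ℝ) ^ r * mahler z ^ n := by positivity
      linarith
    · exact_mod_cast h
  set R : ℂ → ℝ := fun w => n * max 1 ‖w‖ ^ n with hR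
  have hRpos : ∀ w, 0 < R w := fun w => by
    have : (0 : ℝ) < max 1 ‖w‖ := lt_max_of_lt_left one_pos
    positivity
  -- One real coordinate per conjugate: a nonreal pair shares its real and imaginary parts between
  -- its two members. This gives the exponent `r` rather than `2 * r`. The scaling by `R w` puts
  -- every coordinate in `[-k, k]`.
  let cell : (Fin n → ℤˣ) → ((conjRoots z).toFinset → ℤ) := fun s w =>
    ⌊(k : ℝ) * placeCoord w (signedSum w n s) / R w⌋
  have hfac : Function.FactorsThrough (signedSum z n) cell := by
    intro s t hst
    refine signedSum_eq_of_prod_lt_one hz hu ?_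
    have hcoord : ∀ w ∈ conjRoots z,
        |placeCoord w (signedSum w n s - signedSum w n t)| ≤ R w / k := by
      intro w hw
      have h1 := congrFun hst ⟨w, Multiset.mem_toFinset.mpr hw⟩
      have h2 := (Int.abs_sub_lt_one_of_floor_eq_floor h1).le
      rw [placeCoord_sub]
      rw [← sub_div, ← mul_sub, abs_div, abs_mul, abs_of_pos (hRpos w), abs_of_pos hk0,
        div_le_one (hRpos w)] at h2
      rw [le_div_iff₀ hk0]
      linarith
    have hnorm : ∀ w ∈ conjRoots z, ‖aeval w (halfDiff s t)‖ ≤ R w / k := by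
      intro w hw
      have h1 : ‖signedSum w n s - signedSum w n t‖ ≤ 2 * (R w / k) := by
        refine norm_le_of_placeCoord (f := fun w => signedSum w n s - signedSum w n t)
          (fun w => by simp [signedSum_conj]) (hcoord w hw) ?_
        refine (hcoord _ (conj_mem_conjRoots hw)).trans (le_of_eq ?_)
        simp [hR]
      -- The factor `2` lost in combining two coordinates cancels the factor `2` in front of the
      -- half difference.
      rw [signedSum_sub, norm_mul, Complex.norm_ofNat] at h1
      linarith
    calc ((conjRoots z).map fun w => ‖aeval w (halfDiff s t)‖).prod
        ≤ ((conjRoots z).map fun w => R w / k).prod :=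
          Multiset.prod_map_le_prod_map₀ _ _ (fun w _ => norm_nonneg _) hnorm
      _ = (n / k : ℝ) ^ r * mahler z ^ n := by
          rw [mahler_eq_prod_conjRoots hu, ← Multiset.prod_map_pow, hr, ← card_conjRoots,
            ← Multiset.prod_replicate, ← Multiset.map_const', ← Multiset.prod_map_mul]
          congr 2
          ext w
          simp only [hR]
          ring
      _ < 1 := by
          rw [div_pow, div_mul_eq_mul_div, div_lt_one (by positivity)]
          refine lt_of_le_of_lt ?_ hk
          gcongr
          linarith
  obtain ⟨g, hg⟩ := (Function.factorsThrough_iff _).mp hfac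
  have hsub : Finset.univ.image cell ⊆ Fintype.piFinset fun _ => Finset.Icc (-(k : ℤ)) k := by
    intro c hc
    obtain ⟨s, -, rfl⟩ := Finset.mem_image.mp hc
    rw [Fintype.mem_piFinset]
    intro w
    have h1 : |(k : ℝ) * placeCoord w (signedSum w n s) / R w| ≤ k := by
      rw [abs_div, abs_mul, abs_of_pos (hRpos w), abs_of_pos hk0, div_le_iff₀ (hRpos w)]
      have := (abs_placeCoord_le w (signedSum w n s)).trans (norm_signedSum_le w n s)
      gcongr
    rw [abs_le] at h1
    rw [Finset.mem_Icc]
    constructor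
    · rw [Int.le_floor]
      push_cast
      exact h1.1
    · have := (Int.floor_le ((k : ℝ) * placeCoord w (signedSum w n s) / R w)).trans h1.2
      exact_mod_cast this
  calc (Finset.univ.image (signedSum z n)).card
      ≤ (Finset.univ.image cell).card := by
        rw [hg, ← Finset.image_image]
        exact Finset.card_image_le
    _ ≤ (Fintype.piFinset fun _ : (conjRoots z).toFinset => Finset.Icc (-(k : ℤ)) k).card :=
        Finset.card_le_card hsub
    _ = (2 * k + 1) ^ (conjRoots z).toFinset.card := by
        rw [Fintype.card_piFinset, Finset.prod_const, Int.card_Icc, Finset.card_univ,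
          Fintype.card_coe]
        congr 1
        omega
    _ ≤ (2 * k + 1) ^ r := by
        refine Nat.pow_le_pow_right (by omega) ?_
        rw [hr, ← card_conjRoots]
        exact Multiset.toFinset_card_le _

/-- The count of values is at most `(7 n) ^ r * M ^ n`; the polynomial factor disappears after
taking the logarithm and dividing by `n`. -/
theorem entropyRate_le_logb_mahler_of_lt_two {z : ℂ} (hz : IsAlgebraic ℚ z)
    (h2 : mahler z < 2) : entropyRate z ≤ Real.logb 2 (mahler z) := by
  have hu := isUnit_leadingCoeff_of_mahler_lt_two hz h2
  have hM : 1 ≤ mahler z := one_le_mahler hz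
  set M := mahler z
  set r := (intMinpoly z).natDegree with hr
  have hr0 : r ≠ 0 := by
    rw [hr, ← card_conjRoots]
    intro h
    have : z ∈ conjRoots z := (mem_conjRoots hz).mpr (intMinpoly_spec hz).2
    rw [Multiset.card_eq_zero.mp h] at this
    exact absurd this (Multiset.notMem_zero _)
  have hr' : (r : ℝ) ≠ 0 := by exact_mod_cast hr0
  have hlim : Tendsto (fun n : ℕ => r * (Real.logb 2 7 / n + Real.logb 2 n / n) + Real.logb 2 M)
      atTop (𝓝 (r * (0 + 0) + Real.logb 2 M)) := by
    refine ((Tendsto.add ?_ ?_).const_mul _).add_const _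
    · exact tendsto_const_div_atTop_nhds_zero_nat _
    · have h1 : Tendsto (fun x : ℝ => Real.log x / x) atTop (𝓝 0) := by
        simpa using Real.isLittleO_log_id_atTop.tendsto_div_nhds_zero
      have h3 := (h1.comp tendsto_natCast_atTop_atTop).div_const (Real.log 2)
      rw [zero_div] at h3
      refine h3.congr fun n => ?_
      simp only [Function.comp, Real.logb]
      ring
  rw [add_zero, mul_zero, zero_add] at hlim
  refine le_of_tendsto_of_tendsto (tendsto_normalizedEntropy z) hlim ?_
  filter_upwards [eventually_gt_atTop 0] with n hn
  have hn' : (1 : ℝ) ≤ n := by exact_mod_cast hn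
  set t : ℝ := M ^ ((n : ℝ) / r) with ht
  have ht1 : 1 ≤ t := Real.one_le_rpow hM (by positivity)
  have htr : t ^ r = M ^ n := by
    rw [ht, ← Real.rpow_natCast, ← Real.rpow_mul (by positivity), div_mul_cancel₀ _ hr',
      Real.rpow_natCast]
  -- Essentially the smallest admissible `k`, since the pigeonhole condition is `(2 * n * t) ^ r < k
  -- ^ r`. Then `2 * k + 1 ≤ 4 * n * t + 3 ≤ 7 * n * t`.
  set k : ℕ := ⌊2 * n * t⌋₊ + 1 with hk
  have hk1 : 2 * n * t < k := by
    rw [hk]; push_cast; exact Nat.lt_floor_add_one _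
  have hk2 : (k : ℝ) ≤ 2 * n * t + 1 := by
    rw [hk]; push_cast; gcongr; exact Nat.floor_le (by positivity)
  have hcard := card_image_signedSum_le hz hu hn (k := k) (by
    rw [← hr, ← htr, ← mul_pow]
    exact pow_lt_pow_left₀ hk1 (by positivity) hr0)
  have hnt : 1 ≤ n * t := by nlinarith
  have hcard2 : ((Finset.univ.image (signedSum z n)).card : ℝ) ≤ (7 * n) ^ r * M ^ n := by
    rw [← htr, ← mul_pow]
    calc ((Finset.univ.image (signedSum z n)).card : ℝ) ≤ (2 * k + 1 : ℝ) ^ r := by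
          exact_mod_cast hcard
      _ ≤ _ := by
          gcongr
          linarith
  have := shannonEntropy_map_uniform_le_of_card_image_le _ hcard2
  rw [← signedSumLaw_eq, Real.logb_mul (by positivity) (by positivity), Real.logb_pow,
    Real.logb_pow, Real.logb_mul (by norm_num) (by positivity)] at this
  rw [normalizedEntropy, div_le_iff₀ (by positivity)]
  refine this.trans (le_of_eq ?_)
  field_simp

theorem entropyRate_le_min {z : ℂ} (hz : IsAlgebraic ℚ z) :
    entropyRate z ≤ min 1 (Real.logb 2 (mahler z)) := by
  refine le_min (entropyRate_le_one z) ?_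
  rcases lt_or_ge (mahler z) 2 with h | h
  · exact entropyRate_le_logb_mahler_of_lt_two hz h
  · refine (entropyRate_le_one z).trans ?_
    rw [Real.le_logb_iff_rpow_le (by norm_num) (by linarith)]
    simpa using h

/-! ### Conditional entropy for families of densities -/

open MeasureTheory ProbabilityTheory

/-- The perspective `u log (T / u)` of the logarithm. -/
def kern (u T : ℝ) : ℝ := u * Real.log (T / u)

theorem kern_nonneg {u T : ℝ} (hu : 0 < u) (h : u ≤ T) : 0 ≤ kern u T :=
  mul_nonneg hu.le (Real.log_nonneg ((one_le_div hu).mpr h))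

/-- Tangent line bound: `kern` is concave and homogeneous. -/
theorem kern_le_tangent {u T u₀ T₀ : ℝ} (hu : 0 < u) (hT : 0 < T) (hu₀ : 0 < u₀) (hT₀ : 0 < T₀) :
    kern u T ≤ u * (Real.log (T₀ / u₀) - 1) + T * (u₀ / T₀) := by
  have h := Real.log_le_sub_one_of_pos (show 0 < (T * u₀) / (u * T₀) by positivity)
  rw [Real.log_div (by positivity) (by positivity), Real.log_mul hT.ne' hu₀.ne',
    Real.log_mul hu.ne' hT₀.ne'] at h
  rw [kern, Real.log_div hT.ne' hu.ne', Real.log_div hT₀.ne' hu₀.ne']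
  have h2 := mul_le_mul_of_nonneg_left h hu.le
  have h3 : u * (T * u₀ / (u * T₀) - 1) = T * (u₀ / T₀) - u := by field_simp
  rw [h3] at h2
  linarith

theorem kern_le {u T : ℝ} (hu : 0 < u) (hT : 0 < T) : kern u T ≤ T := by
  have := kern_le_tangent hu hT one_pos one_pos
  simp only [div_one, Real.log_one] at this
  linarith

theorem kern_mul {c u T : ℝ} (hc : 0 < c) : kern (c * u) (c * T) = c * kern u T := by
  rw [kern, kern, mul_div_mul_left _ _ hc.ne', mul_assoc]

theorem le_sum_of_pos {ι α : Type*} [Fintype ι] {f : ι → α → ℝ} (hf : ∀ s z, 0 < f s z) (s : ι)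
    (z : α) : f s z ≤ ∑ s', f s' z :=
  Finset.single_le_sum (f := fun s => f s z) (fun i _ => (hf i z).le) (Finset.mem_univ s)

variable {E : Type*} [NormedAddCommGroup E] [InnerProductSpace ℝ E] [FiniteDimensional ℝ E]
  [MeasurableSpace E] [BorelSpace E]

/-- Positive, bounded, continuous and integrable functions. -/
structure IsNiceDensity (f : E → ℝ) : Prop where
  cont : Continuous f
  pos : ∀ z, 0 < f z
  int : Integrable f
  bdd : ∃ C, ∀ z, f z ≤ C

namespace IsNiceDensity

variable {f g : E → ℝ}

theorem sum {ι : Type*} [Fintype ι] [Nonempty ι] {f : ι → E → ℝ}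
    (hf : ∀ i, IsNiceDensity (f i)) : IsNiceDensity fun z => ∑ i, f i z where
  cont := continuous_finsetSum _ fun i _ => (hf i).cont
  pos z := Finset.sum_pos (fun i _ => (hf i).pos z) Finset.univ_nonempty
  int := integrable_finsetSum _ fun i _ => (hf i).int
  bdd := by
    choose C hC using fun i => (hf i).bdd
    exact ⟨∑ i, C i, fun z => Finset.sum_le_sum fun i _ => hC i z⟩

theorem integrable_kern (hf : IsNiceDensity f) (hg : IsNiceDensity g) (h : ∀ z, f z ≤ g z) :
    Integrable fun z => kern (f z) (g z) := by
  refine hg.int.mono' ?_ (ae_of_all _ fun z => ?_)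
  · refine Continuous.aestronglyMeasurable (hf.cont.mul ((hg.cont.div hf.cont fun z =>
      (hf.pos z).ne').log fun z => (div_pos (hg.pos z) (hf.pos z)).ne'))
  · rw [Real.norm_of_nonneg (kern_nonneg (hf.pos z) (h z))]
    exact kern_le (hf.pos z) (hg.pos z)

theorem continuous_kern (hf : IsNiceDensity f) (hg : IsNiceDensity g) :
    Continuous fun z => kern (f z) (g z) :=
  hf.cont.mul ((hg.cont.div hf.cont fun z => (hf.pos z).ne').log fun z =>
    (div_pos (hg.pos z) (hf.pos z)).ne')

end IsNiceDensity

/-- The (unnormalized) conditional entropy of the index of a family of densities. -/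
def condEnt {ι : Type*} [Fintype ι] (f : ι → E → ℝ) : ℝ :=
  ∑ s, ∫ z, kern (f s z) (∑ s', f s' z)

section condEnt

variable {ι : Type*} [Fintype ι] {f : ι → E → ℝ}

/-- Uncertainty about an index is at most the logarithm of the number of indices. The tangent to
`kern` is taken at the ratio `T / u = card ι`, the case of equal densities. -/
theorem condEnt_le [Nonempty ι] (hf : ∀ s, IsNiceDensity (f s)) :
    condEnt f ≤ (∑ s, ∫ z, f s z) * Real.log (Fintype.card ι) := by
  have hc : (0 : ℝ) < Fintype.card ι := by exact_mod_cast Fintype.card_pos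
  have hT := IsNiceDensity.sum hf
  have h1 : ∀ s, ∫ z, kern (f s z) (∑ s', f s' z) ≤
      (∫ z, f s z) * (Real.log (Fintype.card ι) - 1) +
        (∫ z, ∑ s', f s' z) * (1 / Fintype.card ι) := by
    intro s
    rw [← integral_mul_const, ← integral_mul_const, ← integral_add ((hf s).int.mul_const _)
      (hT.int.mul_const _)]
    refine integral_mono ((hf s).integrable_kern hT (le_sum_of_pos (fun i => (hf i).pos) s))
      (((hf s).int.mul_const _).add (hT.int.mul_const _)) fun z => ?_
    have := kern_le_tangent ((hf s).pos z) (hT.pos z) one_pos hc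
    rw [div_one] at this
    exact this
  rw [condEnt]
  refine (Finset.sum_le_sum fun s _ => h1 s).trans (le_of_eq ?_)
  rw [Finset.sum_add_distrib, ← Finset.sum_mul, Finset.sum_const, nsmul_eq_mul, Finset.card_univ,
    integral_finsetSum _ fun s _ => (hf s).int]
  field_simp
  ring

/-- A noisy observation of `X` leaves at least the uncertainty that `X` itself leaves: indices in
the same fibre have the same density, so the total density is at least `fiberCard` times each of
them. -/
theorem le_condEnt {α : Type*} {X : ι → α} {g : α → E → ℝ} [Nonempty ι]
    (hf : ∀ s, IsNiceDensity (g (X s))) :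
    ∑ s, (∫ z, g (X s) z) * Real.log (fiberCard X s) ≤ condEnt fun s => g (X s) := by
  classical
  have hT := IsNiceDensity.sum hf
  refine Finset.sum_le_sum fun s _ => ?_
  rw [← integral_mul_const]
  refine integral_mono ((hf s).int.mul_const _)
    ((hf s).integrable_kern hT (le_sum_of_pos (fun i => (hf i).pos) s)) fun z => ?_
  have h0 := (hf s).pos z
  refine mul_le_mul_of_nonneg_left ?_ h0.le
  refine Real.log_le_log (by exact_mod_cast fiberCard_pos X s) ?_
  rw [le_div_iff₀ h0, fiberCard_eq, ← nsmul_eq_mul, ← Finset.sum_const]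
  refine (Finset.sum_le_sum (g := fun i => g (X i) z) fun i hi => ?_).trans
    (Finset.sum_le_univ_sum_of_nonneg fun i => ((hf i).pos z).le)
  rw [(Finset.mem_filter.mp hi).2]

/-- Chain rule for conditional entropy. -/
theorem condEnt_prod {κ : Type*} [Fintype κ] [Nonempty κ] [Nonempty ι] {f : κ × ι → E → ℝ}
    (hf : ∀ p, IsNiceDensity (f p)) :
    condEnt f = condEnt (fun s z => ∑ b, f (b, s) z) + ∑ s, condEnt (fun b => f (b, s)) := by
  have hm : ∀ s, IsNiceDensity fun z => ∑ b, f (b, s) z := fun s =>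
    IsNiceDensity.sum fun b => hf (b, s)
  have hT : IsNiceDensity fun z => ∑ s, ∑ b, f (b, s) z := IsNiceDensity.sum hm
  have hle : ∀ s z, ∑ b, f (b, s) z ≤ ∑ s, ∑ b, f (b, s) z :=
    le_sum_of_pos (fun s => (hm s).pos)
  have hle' : ∀ b s z, f (b, s) z ≤ ∑ b, f (b, s) z := fun b s z =>
    le_sum_of_pos (f := fun b => f (b, s)) (fun b => (hf (b, s)).pos) b z
  have h1 : ∀ s, ∑ b, ∫ z, kern (f (b, s) z) (∑ s', f s' z) =
      (∫ z, kern (∑ b, f (b, s) z) (∑ s', ∑ b, f (b, s') z)) + condEnt (fun b => f (b, s)) := by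
    intro s
    rw [condEnt, ← integral_finsetSum _ fun b _ => (hf (b, s)).integrable_kern (hm s) (hle' b s),
      ← integral_finsetSum, ← integral_add ((hm s).integrable_kern hT (hle s))]
    · refine integral_congr_ae (ae_of_all _ fun z => ?_)
      have h2 : ∑ s', f s' z = ∑ s', ∑ b, f (b, s') z := by
        rw [Fintype.sum_prod_type_right]
      simp only [h2, kern]
      have hmz := (hm s).pos z
      have hTz := hT.pos z
      rw [Finset.sum_mul, ← Finset.sum_add_distrib]
      refine Finset.sum_congr rfl fun b _ => ?_
      have hb := (hf (b, s)).pos z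
      rw [Real.log_div hTz.ne' hb.ne', Real.log_div hTz.ne' hmz.ne', Real.log_div hmz.ne' hb.ne']
      ring
    · exact integrable_finsetSum _ fun b _ =>
        (hf (b, s)).integrable_kern (hm s) (hle' b s)
    · intro b _
      have := (hf (b, s)).integrable_kern hT fun z => (hle' b s z).trans (hle s z)
      simpa only [Fintype.sum_prod_type_right] using this
  rw [condEnt, Fintype.sum_prod_type_right, Finset.sum_congr rfl fun s _ => h1 s,
    Finset.sum_add_distrib, condEnt]

theorem condEnt_translate (f : ι → E → ℝ) (c : E) :
    condEnt (fun s z => f s (z - c)) = condEnt f :=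
  Finset.sum_congr rfl fun s _ =>
    integral_sub_right_eq_self (fun z => kern (f s z) (∑ s', f s' z)) c

theorem measurableEmbedding_linearMap {B : E →ₗ[ℝ] E} (hB : LinearMap.det B ≠ 0) :
    MeasurableEmbedding B :=
  (LinearMap.equivOfDetNeZero B hB).toContinuousLinearEquiv.toHomeomorph.measurableEmbedding

theorem integral_comp_linearMap {B : E →ₗ[ℝ] E} (hB : LinearMap.det B ≠ 0) (h : E → ℝ) :
    ∫ z, h (B z) = |(LinearMap.det B)⁻¹| * ∫ z, h z := by
  have := (measurableEmbedding_linearMap hB).integral_map (μ := volume) h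
  rw [← this, Measure.map_linearMap_addHaar_eq_smul_addHaar _ hB, integral_smul_measure,
    ENNReal.toReal_ofReal (abs_nonneg _), smul_eq_mul]

theorem integrable_comp_linearMap {B : E →ₗ[ℝ] E} (hB : LinearMap.det B ≠ 0) {h : E → ℝ}
    (hh : Integrable h) : Integrable fun z => h (B z) := by
  have := (measurableEmbedding_linearMap hB).integrable_map_iff (μ := volume) (g := h)
  refine this.mp ?_
  rw [Measure.map_linearMap_addHaar_eq_smul_addHaar _ hB]
  exact hh.smul_measure ENNReal.ofReal_ne_top

/-- Invariance under a linear change of the observed variable: the Jacobian cancels because `kern`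
is homogeneous of degree one. -/
theorem condEnt_comp {B : E →ₗ[ℝ] E} {c : ℝ} (hc : 0 < c) (hcB : |LinearMap.det B| = c)
    (f : ι → E → ℝ) : condEnt (fun s z => c * f s (B z)) = condEnt f := by
  have hB : LinearMap.det B ≠ 0 := by
    intro h; rw [h, abs_zero] at hcB; exact hc.ne hcB
  refine Finset.sum_congr rfl fun s _ => ?_
  simp only [← Finset.mul_sum, kern_mul hc]
  rw [integral_const_mul, integral_comp_linearMap hB (fun z => kern (f s z) (∑ s', f s' z)),
    abs_inv, hcB, mul_inv_cancel_left₀ hc.ne']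

theorem integrable_translates {h : E → ℝ} (hc : Continuous h) (hi : Integrable h) (w : E)
    (γ : Measure ℝ) [IsProbabilityMeasure γ] :
    Integrable (fun p : E × ℝ => h (p.1 - p.2 • w)) ((volume : Measure E).prod γ) := by
  rw [integrable_prod_iff' (Continuous.aestronglyMeasurable (by fun_prop))]
  constructor
  · exact ae_of_all _ fun t => hi.comp_sub_right (t • w)
  · simp only [integral_sub_right_eq_self (fun z => ‖h z‖)]
    exact integrable_const _

theorem integral_integral_translates {h : E → ℝ} (hc : Continuous h) (hi : Integrable h) (w : E)
    (γ : Measure ℝ) [IsProbabilityMeasure γ] :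
    ∫ z, ∫ t, h (z - t • w) ∂γ = ∫ z, h z := by
  rw [integral_integral_swap (integrable_translates hc hi w γ)]
  simp [integral_sub_right_eq_self]

/-- Data processing inequality: adding an independent noise increases the conditional entropy. -/
theorem condEnt_le_average [Nonempty ι] {g : ι → E → ℝ} (w : E) (γ : Measure ℝ)
    [IsProbabilityMeasure γ]
    (hf : ∀ s, IsNiceDensity (f s)) (hg : ∀ s, IsNiceDensity (g s))
    (hfg : ∀ s z, g s z = ∫ t, f s (z - t • w) ∂γ) : condEnt f ≤ condEnt g := by
  have hF := IsNiceDensity.sum hf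
  have hG := IsNiceDensity.sum hg
  have hint : ∀ s z, Integrable (fun t : ℝ => f s (z - t • w)) γ := by
    intro s z
    obtain ⟨C, hC⟩ := (hf s).bdd
    refine Integrable.of_bound (C := C) ?_ (ae_of_all _ fun t => ?_)
    · have := (hf s).cont
      exact Continuous.aestronglyMeasurable (by fun_prop)
    · rw [Real.norm_of_nonneg ((hf s).pos _).le]
      exact hC _
  refine Finset.sum_le_sum fun s _ => ?_
  have hki := (hf s).integrable_kern hF (le_sum_of_pos (fun i => (hf i).pos) s)
  have hkc := (hf s).continuous_kern hF
  rw [← integral_integral_translates hkc hki w γ]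
  refine integral_mono (integrable_translates hkc hki w γ).integral_prod_left
    ((hg s).integrable_kern hG (le_sum_of_pos (fun i => (hg i).pos) s)) fun z => ?_
  simp only
  have hu := (hg s).pos z
  have hT := hG.pos z
  have hG' : ∑ s', g s' z = ∫ t, ∑ s', f s' (z - t • w) ∂γ := by
    rw [integral_finsetSum _ fun s' _ => hint s' z]
    exact Finset.sum_congr rfl fun s' _ => hfg s' z
  have hintF : Integrable (fun t : ℝ => ∑ s', f s' (z - t • w)) γ :=
    integrable_finsetSum _ fun s' _ => hint s' z
  set u₀ := g s z with hu₀
  set T₀ := ∑ s', g s' z with hT₀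
  -- Jensen's inequality for the concave `kern`, by integrating the tangent at the averaged point
  -- `(u₀, T₀)`, where the tangent is exact.
  have h1 : ∫ t, kern (f s (z - t • w)) (∑ s', f s' (z - t • w)) ∂γ ≤
      ∫ t, (f s (z - t • w) * (Real.log (T₀ / u₀) - 1) +
        (∑ s', f s' (z - t • w)) * (u₀ / T₀)) ∂γ := by
    refine integral_mono ?_ (((hint s z).mul_const _).add (hintF.mul_const _)) fun t =>
      kern_le_tangent ((hf s).pos _) (hF.pos _) hu hT
    refine hintF.mono' ?_ (ae_of_all _ fun t => ?_)
    · exact Continuous.aestronglyMeasurable (hkc.comp (by fun_prop : Continuous fun t : ℝ =>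
        z - t • w))
    · rw [Real.norm_of_nonneg (kern_nonneg ((hf s).pos _)
        (le_sum_of_pos (fun i => (hf i).pos) s _))]
      exact kern_le ((hf s).pos _) (hF.pos _)
  refine h1.trans (le_of_eq ?_)
  rw [integral_add ((hint s z).mul_const _) (hintF.mul_const _), integral_mul_const,
    integral_mul_const, ← hG', ← hfg s z, kern]
  field_simp
  ring

end condEnt

/-! ### Gaussian noise and rank one contractions -/

/-- The conditional entropy (in nats) of a fair sign `ε` given `s ε + G`, where `G` is a standard
normal variable. -/
def errEnt (s : ℝ) : ℝ :=
  ∫ x, Real.log (1 + Real.exp (-2 * (s * x) - 2 * s ^ 2)) ∂(gaussianReal 0 1)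

variable {E : Type*} [NormedAddCommGroup E]

/-- The unnormalized standard Gaussian density. -/
def gauss (z : E) : ℝ := Real.exp (-‖z‖ ^ 2 / 2)

theorem gauss_pos (z : E) : 0 < gauss z := Real.exp_pos _

theorem continuous_gauss : Continuous (gauss : E → ℝ) := by
  unfold gauss
  fun_prop

variable [InnerProductSpace ℝ E]

theorem gauss_sub_add (z v : E) :
    gauss (z + (2 : ℝ) • v) = gauss z * Real.exp (-2 * inner ℝ v z - 2 * ‖v‖ ^ 2) := by
  rw [gauss, gauss, ← Real.exp_add]
  congr 1
  rw [norm_add_sq_real, inner_smul_right, norm_smul, Real.norm_ofNat, real_inner_comm]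
  ring

/-- The contraction `B` satisfies `‖B z‖² = ‖z‖² - ⟪u, z⟫²`. -/
structure IsRankOneContraction (B : E →ₗ[ℝ] E) (u : E) : Prop where
  norm_sq : ∀ z, ‖B z‖ ^ 2 = ‖z‖ ^ 2 - inner ℝ u z ^ 2
  det_ne : LinearMap.det B ≠ 0

namespace IsRankOneContraction

variable [FiniteDimensional ℝ E] {B : E →ₗ[ℝ] E} {u : E}

theorem norm_lt_one (h : IsRankOneContraction B u) : ‖u‖ < 1 := by
  rcases eq_or_ne u 0 with h0 | h0
  · simp [h0]
  have h1 := h.norm_sq u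
  rw [real_inner_self_eq_norm_sq] at h1
  have h2 : B u ≠ 0 := by
    intro h3
    have hinj := (LinearMap.equivOfDetNeZero B h.det_ne).injective
    exact h0 (hinj (by simpa using h3))
  have h3 : 0 < ‖B u‖ ^ 2 := by have := norm_pos_iff.mpr h2; positivity
  have h4 : 0 < ‖u‖ ^ 2 := by have := norm_pos_iff.mpr h0; positivity
  have h5 : ‖u‖ ^ 2 < 1 := by nlinarith
  exact (sq_lt_one_iff₀ (norm_nonneg _)).mp h5

/-- The convolution of the Gaussian density with a Gaussian in direction `u`. -/
theorem integral_gauss_line (h : IsRankOneContraction B u) (z : E) :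
    ∫ t, gauss (z - t • ((√(1 - ‖u‖ ^ 2))⁻¹ • u)) ∂(gaussianReal 0 1) =
      √(1 - ‖u‖ ^ 2) * gauss (B z) := by
  set β := √(1 - ‖u‖ ^ 2) with hβ
  have h1 : 0 < 1 - ‖u‖ ^ 2 := by
    have := (sq_lt_one_iff₀ (norm_nonneg u)).mpr h.norm_lt_one
    linarith
  have hβ0 : 0 < β := Real.sqrt_pos.mpr h1
  have hβ2 : ‖u‖ ^ 2 = 1 - β ^ 2 := by rw [hβ, Real.sq_sqrt h1.le]; ring
  rw [integral_gaussianReal_eq_integral_smul one_ne_zero]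
  -- Completing the square in `t`. The direction `β⁻¹ • u` is dictated by `(1 - u uᵀ)⁻¹ = 1 + β⁻² u
  -- uᵀ`, the covariance of `B⁻¹ G`.
  have hpt : ∀ t : ℝ, gaussianPDFReal 0 1 t • gauss (z - t • (β⁻¹ • u)) =
      ((√(2 * Real.pi))⁻¹ * gauss (B z)) *
        Real.exp (-(β⁻¹ ^ 2 / 2) * (t - β * inner ℝ u z) ^ 2) := by
    intro t
    rw [gaussianPDFReal, smul_eq_mul, gauss, gauss, h.norm_sq, norm_sub_sq_real, inner_smul_right,
      inner_smul_right, norm_smul, norm_smul, real_inner_comm z u, mul_pow, mul_pow, hβ2,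
      Real.norm_eq_abs, Real.norm_eq_abs, sq_abs, sq_abs, NNReal.coe_one, mul_one, mul_one,
      sub_zero, mul_assoc, mul_assoc, ← Real.exp_add, ← Real.exp_add]
    congr 2
    field_simp
    ring
  simp_rw [hpt]
  rw [integral_const_mul, integral_sub_right_eq_self
    (fun t => Real.exp (-(β⁻¹ ^ 2 / 2) * t ^ 2)), integral_gaussian]
  have : Real.pi / (β⁻¹ ^ 2 / 2) = β ^ 2 * (2 * Real.pi) := by field_simp
  rw [this, Real.sqrt_mul (sq_nonneg β), Real.sqrt_sq hβ0.le]
  have : √(2 * Real.pi) ≠ 0 := by positivity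
  field_simp

end IsRankOneContraction

variable [FiniteDimensional ℝ E] [MeasurableSpace E] [BorelSpace E]

theorem integral_gauss_mul_cexp (c : ℂ) (w : E) :
    ∫ z : E, (gauss z : ℂ) * Complex.exp (c * (inner ℝ w z : ℝ)) =
      (Real.pi / (1 / 2 : ℂ)) ^ (Module.finrank ℝ E / 2 : ℂ) *
        Complex.exp (c ^ 2 * ‖w‖ ^ 2 / 2) := by
  have h := GaussianFourier.integral_cexp_neg_mul_sq_norm_add (b := (1 / 2 : ℂ)) (V := E)
    (by norm_num) c w
  rw [show (4 * (1 / 2 : ℂ)) = 2 by norm_num] at h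
  rw [← h]
  refine integral_congr_ae (ae_of_all _ fun z => ?_)
  simp only [gauss, Complex.exp_add]
  push_cast
  congr 2
  ring

theorem integrable_gauss : Integrable (gauss : E → ℝ) := by
  have h := (GaussianFourier.integrable_cexp_neg_mul_sq_norm_add (b := (1 / 2 : ℂ)) (V := E)
    (by norm_num) 0 0).norm
  refine h.congr (ae_of_all _ fun z => ?_)
  simp only [gauss]
  rw [Complex.norm_exp]
  congr 1
  have : (-(1 / 2 : ℂ) * (‖z‖ : ℂ) ^ 2 + 0 * ((inner ℝ (0 : E) z : ℝ) : ℂ)) =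
      ((-‖z‖ ^ 2 / 2 : ℝ) : ℂ) := by push_cast; ring
  rw [this, Complex.ofReal_re]

variable (E) in
/-- The total mass of the unnormalized Gaussian density. -/
def gaussMass : ℝ := ∫ z : E, gauss z

variable (E) in
theorem gaussMass_pos : 0 < gaussMass E := by
  refine (integral_pos_iff_support_of_nonneg (fun z => (gauss_pos z).le) integrable_gauss).mpr ?_
  have : Function.support (gauss : E → ℝ) = Set.univ := by
    ext z; simp [(gauss_pos z).ne']
  rw [this]
  exact isOpen_univ.measure_pos _ Set.univ_nonempty

theorem gauss_isNice (c : E) : IsNiceDensity fun z : E => gauss (z - c) where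
  cont := continuous_gauss.comp (by fun_prop)
  pos z := gauss_pos _
  int := integrable_gauss.comp_sub_right c
  bdd := ⟨1, fun z => Real.exp_le_one_iff.mpr (by have := sq_nonneg ‖z - c‖; linarith)⟩

theorem integral_gauss_sub (c : E) : ∫ z : E, gauss (z - c) = gaussMass E :=
  integral_sub_right_eq_self _ c

/-- Linear functionals of a standard Gaussian vector are Gaussian. -/
theorem integral_gauss_mul_inner (v : E) {h : ℝ → ℝ} (hh : Continuous h) :
    ∫ z : E, gauss z * h (inner ℝ v z) =
      gaussMass E * ∫ x, h (‖v‖ * x) ∂(gaussianReal 0 1) := by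
  have hmeas : Measurable fun z : E => (gauss z).toNNReal :=
    continuous_gauss.measurable.real_toNNReal
  have hin : Measurable fun z : E => (inner ℝ v z : ℝ) := by fun_prop
  set ν : Measure E := volume.withDensity fun z => ((gauss z).toNNReal : ENNReal) with hν
  have hfin : IsFiniteMeasure ν :=
    isFiniteMeasure_withDensity_ofReal integrable_gauss.2
  have hνint : ∀ {F : Type} [NormedAddCommGroup F] [NormedSpace ℝ F] (g : E → F),
      ∫ z, g z ∂ν = ∫ z, gauss z • g z := by
    intro F _ _ g
    rw [hν, integral_withDensity_eq_integral_smul hmeas]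
    refine integral_congr_ae (ae_of_all _ fun z => ?_)
    simp only [NNReal.smul_def, Real.coe_toNNReal _ (gauss_pos z).le]
  have hmass : (gaussMass E : ℂ) =
      (Real.pi / (1 / 2 : ℂ)) ^ (Module.finrank ℝ E / 2 : ℂ) := by
    have := integral_gauss_mul_cexp (E := E) 0 0
    simp only [zero_mul, Complex.exp_zero, mul_one, ne_eq, OfNat.ofNat_ne_zero, not_false_eq_true,
      zero_pow, zero_div] at this
    rw [← this, gaussMass, integral_complex_ofReal]
  -- Both finite measures on the line are identified by their characteristic functions.
  have key : ν.map (fun z => (inner ℝ v z : ℝ)) =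
      (gaussMass E).toNNReal • (gaussianReal 0 1).map (‖v‖ * ·) := by
    refine Measure.ext_of_charFun ?_
    funext t
    have h1 : charFun (ν.map (fun z => (inner ℝ v z : ℝ))) t =
        gaussMass E * Complex.exp (-(t ^ 2 * ‖v‖ ^ 2) / 2) := by
      rw [charFun_apply_real, integral_map hin.aemeasurable
        (Continuous.aestronglyMeasurable (by fun_prop)), hνint, hmass]
      have := integral_gauss_mul_cexp (t * Complex.I) v
      rw [mul_pow, Complex.I_sq, mul_neg_one, neg_mul] at this
      rw [← this]
      refine integral_congr_ae (ae_of_all _ fun z => ?_)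
      simp only [Complex.real_smul]
      congr 2
      ring
    have h2 : charFun ((gaussMass E).toNNReal • (gaussianReal 0 1).map (‖v‖ * ·)) t =
        gaussMass E * charFun ((gaussianReal 0 1).map (‖v‖ * ·)) t := by
      rw [charFun_apply_real, charFun_apply_real, integral_smul_nnreal_measure, NNReal.smul_def,
        Real.coe_toNNReal _ (gaussMass_pos E).le, Complex.real_smul]
    rw [h1, h2, gaussianReal_map_const_mul, charFun_gaussianReal]
    congr 2
    push_cast
    simp
    ring
  have h3 : ∫ x, h x ∂(ν.map (fun z => (inner ℝ v z : ℝ))) = ∫ z : E, gauss z * h (inner ℝ v z) := by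
    rw [integral_map hin.aemeasurable hh.aestronglyMeasurable, hνint]
    rfl
  rw [← h3, key, integral_smul_nnreal_measure, NNReal.smul_def,
    Real.coe_toNNReal _ (gaussMass_pos E).le, smul_eq_mul,
    integral_map (by fun_prop) hh.aestronglyMeasurable]

theorem continuous_log_one_add_exp {α : Type*} [TopologicalSpace α] {f : α → ℝ}
    (hf : Continuous f) : Continuous fun x => Real.log (1 + Real.exp (f x)) :=
  Continuous.log (by fun_prop) fun x => by positivity

/-- After recentring at `v`, the ratio of the total to the first density depends on `z` only through
`⟪v, z⟫`, so the integral is one-dimensional. -/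
theorem integral_kern_gauss_pair (v : E) :
    ∫ z : E, kern (gauss (z - v)) (gauss (z - v) + gauss (z + v)) =
      gaussMass E * errEnt ‖v‖ := by
  rw [← integral_sub_right_eq_self _ (-v)]
  have := integral_gauss_mul_inner v (h := fun x => Real.log (1 + Real.exp (-2 * x - 2 * ‖v‖ ^ 2)))
    (continuous_log_one_add_exp (by fun_prop))
  rw [errEnt, ← this]
  refine integral_congr_ae (ae_of_all _ fun z => ?_)
  simp only [sub_neg_eq_add, add_sub_cancel_right, add_assoc]
  rw [← two_smul ℝ v, gauss_sub_add, kern]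
  have := (gauss_pos z).ne'
  congr 2
  field_simp

/-- The Gaussian mixtures with centres `X b s`, `b : κ`. -/
def gaussMix {κ ι : Type*} [Fintype κ] (X : κ → ι → E) (s : ι) (z : E) : ℝ :=
  ∑ b, gauss (z - X b s)

theorem gaussMix_isNice {κ ι : Type*} [Fintype κ] [Nonempty κ] (X : κ → ι → E) (s : ι) :
    IsNiceDensity (gaussMix X s) :=
  IsNiceDensity.sum fun b => gauss_isNice (X b s)

theorem condEnt_gauss_pair (c a : E) :
    condEnt (fun (b : ℤˣ) (z : E) => gauss (z - (c + ((b : ℤ) : ℝ) • a))) =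
      2 * (gaussMass E * errEnt ‖a‖) := by
  have h0 : (fun (b : ℤˣ) (z : E) => gauss (z - (c + ((b : ℤ) : ℝ) • a))) =
      fun b z => (fun (b : ℤˣ) (z : E) => gauss (z - ((b : ℤ) : ℝ) • a)) b (z - c) := by
    funext b z
    simp only
    congr 1
    abel
  rw [h0, condEnt_translate (fun (b : ℤˣ) (z : E) => gauss (z - ((b : ℤ) : ℝ) • a)), condEnt]
  have huniv : (Finset.univ : Finset ℤˣ) = {1, -1} := rfl
  have hne : (1 : ℤˣ) ≠ -1 := by decide
  rw [huniv]
  simp only [Finset.sum_pair hne, Units.val_one, Int.cast_one, one_smul, Units.val_neg,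
    Int.cast_neg, neg_smul, sub_neg_eq_add]
  rw [integral_kern_gauss_pair]
  have := integral_kern_gauss_pair (-a)
  simp only [sub_neg_eq_add, ← sub_eq_add_neg, norm_neg] at this
  simp only [add_comm (gauss (_ - a))]
  rw [this]
  ring

namespace IsRankOneContraction

variable {B : E →ₗ[ℝ] E} {u : E}

/-- Integrate `integral_gauss_line` over `z`: averaging translates preserves the total mass, whereas
composing with `B` divides it by `|det B|`. No matrix computation is needed. -/
theorem abs_det (h : IsRankOneContraction B u) : |LinearMap.det B| = √(1 - ‖u‖ ^ 2) := by
  have h1 := integral_integral_translates continuous_gauss integrable_gauss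
    ((√(1 - ‖u‖ ^ 2))⁻¹ • u) (gaussianReal 0 1)
  simp_rw [h.integral_gauss_line] at h1
  rw [integral_const_mul, integral_comp_linearMap h.det_ne, ← mul_assoc] at h1
  have h2 := (gaussMass_pos E).ne'
  rw [gaussMass] at h2
  have h3 := mul_right_cancel₀ h2 (h1.trans (one_mul _).symm)
  rw [abs_inv] at h3
  exact (eq_of_mul_inv_eq_one h3).symm

/-- All the contraction of `B` is felt along `u`: there the factor is the full determinant. This is
why the starting vector is later taken parallel to `u`. -/
theorem norm_apply_smul (h : IsRankOneContraction B u) (t : ℝ) :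
    ‖B (t • u)‖ = |LinearMap.det B| * ‖t • u‖ := by
  have h1 : 0 < 1 - ‖u‖ ^ 2 := by
    have := (sq_lt_one_iff₀ (norm_nonneg u)).mpr h.norm_lt_one
    linarith
  refine (sq_eq_sq₀ (norm_nonneg _) (by positivity)).mp ?_
  rw [h.norm_sq, h.abs_det, mul_pow, Real.sq_sqrt h1.le, inner_smul_right,
    real_inner_self_eq_norm_sq, norm_smul, mul_pow, Real.norm_eq_abs, sq_abs]
  ring

/-- Rescaling the noise by the contraction increases the conditional entropy. -/
theorem condEnt_gaussMix_le (h : IsRankOneContraction B u) {κ ι : Type*} [Fintype κ] [Nonempty κ]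
    [Fintype ι] [Nonempty ι] (X : κ → ι → E) :
    condEnt (gaussMix X) ≤ condEnt (gaussMix fun b s => B (X b s)) := by
  set β := √(1 - ‖u‖ ^ 2) with hβ
  have hβ0 : 0 < β := by rw [hβ, ← h.abs_det]; exact abs_pos.mpr h.det_ne
  rw [← condEnt_comp hβ0 h.abs_det (gaussMix fun b s => B (X b s))]
  refine condEnt_le_average (β⁻¹ • u) (gaussianReal 0 1) (gaussMix_isNice X) (fun s => ?_) ?_
  · have hn := gaussMix_isNice (fun b s => B (X b s)) s
    obtain ⟨C, hC⟩ := hn.bdd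
    exact ⟨continuous_const.mul (hn.cont.comp B.continuous_of_finiteDimensional),
      fun z => mul_pos hβ0 (hn.pos _), (integrable_comp_linearMap h.det_ne hn.int).const_mul _,
      β * C, fun z => mul_le_mul_of_nonneg_left (hC _) hβ0.le⟩
  · intro s z
    simp only [gaussMix]
    rw [integral_finsetSum, Finset.mul_sum]
    · refine Finset.sum_congr rfl fun b _ => ?_
      rw [← map_sub, ← h.integral_gauss_line]
      refine integral_congr_ae (ae_of_all _ fun t => ?_)
      simp only
      congr 1
      abel
    · intro b _
      refine Integrable.of_bound (C := 1) (Continuous.aestronglyMeasurable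
        (continuous_gauss.comp (by fun_prop))) (ae_of_all _ fun t => ?_)
      rw [Real.norm_of_nonneg (gauss_pos _).le]
      exact Real.exp_le_one_iff.mpr (by have := sq_nonneg ‖z - t • β⁻¹ • u - X b s‖; linarith)

end IsRankOneContraction

variable {E : Type*} [NormedAddCommGroup E] [InnerProductSpace ℝ E] [FiniteDimensional ℝ E]
  [MeasurableSpace E] [BorelSpace E]

/-! ### The telescoping entropy bound -/

theorem condEnt_equiv {ι ι' : Type*} [Fintype ι] [Fintype ι'] (e : ι' ≃ ι) (f : ι → E → ℝ) :
    condEnt (fun s => f (e s)) = condEnt f := by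
  rw [condEnt, condEnt, ← e.sum_comp]
  refine Finset.sum_congr rfl fun s _ => ?_
  congr 1
  funext z
  rw [← e.sum_comp]

/-- One telescoping step: rescaling the noise gains at least the corresponding one-dimensional
entropy difference of a single sign. -/
theorem condEnt_step {B : E →ₗ[ℝ] E} {u : E} (h : IsRankOneContraction B u) {ι : Type*}
    [Fintype ι] [Nonempty ι] (c : ι → E) (v : E) :
    condEnt (fun (p : ℤˣ × ι) (z : E) => gauss (z - (c p.2 + ((p.1 : ℤ) : ℝ) • v))) +
        2 * Fintype.card ι * gaussMass E * (errEnt ‖B v‖ - errEnt ‖v‖) ≤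
      condEnt (fun (p : ℤˣ × ι) (z : E) => gauss (z - B (c p.2 + ((p.1 : ℤ) : ℝ) • v))) := by
  rw [condEnt_prod fun p => gauss_isNice _, condEnt_prod fun p => gauss_isNice _]
  have h1 := h.condEnt_gaussMix_le (fun (b : ℤˣ) (s : ι) => c s + ((b : ℤ) : ℝ) • v)
  have h2 : ∀ s, condEnt (fun (b : ℤˣ) (z : E) => gauss (z - (c s + ((b : ℤ) : ℝ) • v))) =
      2 * (gaussMass E * errEnt ‖v‖) := fun s => condEnt_gauss_pair _ _
  have h3 : ∀ s, condEnt (fun (b : ℤˣ) (z : E) => gauss (z - B (c s + ((b : ℤ) : ℝ) • v))) =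
      2 * (gaussMass E * errEnt ‖B v‖) := fun s => by
    simp only [map_add, map_smul]
    exact condEnt_gauss_pair _ _
  simp only [h2, h3, Finset.sum_const, Finset.card_univ, nsmul_eq_mul]
  change condEnt (fun s z => ∑ b : ℤˣ, gauss (z - (c s + ((b : ℤ) : ℝ) • v))) ≤
    condEnt (fun s z => ∑ b : ℤˣ, gauss (z - B (c s + ((b : ℤ) : ℝ) • v))) at h1
  linarith

/-- Telescoping over scales: at scale `j` the sign with index `j` sits in front of `x 0`, so each of
the `n` rescalings gains the same amount. The total gain is squeezed between the collision entropy
(`le_condEnt`) and `n log 2` (`condEnt_le`). -/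
theorem gaussian_entropy_bound {B : E →ₗ[ℝ] E} {u : E} (h : IsRankOneContraction B u) {x : ℕ → E}
    (hx : ∀ i, B (x (i + 1)) = x i) (n : ℕ) :
    (errEnt ‖B (x 0)‖ - errEnt ‖x 0‖) * n * 2 ^ n ≤ n * 2 ^ n * Real.log 2 -
      ∑ s, Real.log (fiberCard
        (fun s : Fin n → ℤˣ => ∑ i : Fin n, (((s i : ℤˣ) : ℤ) : ℝ) • x i) s) := by
  set D := errEnt ‖B (x 0)‖ - errEnt ‖x 0‖ with hD
  set X : (Fin n → ℤˣ) → E := fun s => ∑ i : Fin n, (((s i : ℤˣ) : ℤ) : ℝ) • x i with hX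
  have hΓ := gaussMass_pos E
  set Γ := gaussMass E
  have hxpow : ∀ j, (B ^ j) (x j) = x 0 := by
    intro j
    induction j with
    | zero => simp
    | succ j ih => rw [pow_succ, Module.End.mul_apply, hx, ih]
  let K : ℕ → ℝ := fun j => condEnt fun (s : Fin n → ℤˣ) (z : E) => gauss (z - (B ^ j) (X s))
  have hstep : ∀ j < n, K j + 2 ^ n * Γ * D ≤ K (j + 1) := by
    intro j hj
    let j' : Fin n := ⟨j, hj⟩
    -- Isolates the sign whose coefficient at this scale is `x 0`.
    let e : (Fin n → ℤˣ) ≃ ℤˣ × ({i // i ≠ j'} → ℤˣ) := Equiv.funSplitAt j' ℤˣ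
    let c : ({i // i ≠ j'} → ℤˣ) → E := fun s => ∑ i, (((s i : ℤˣ) : ℤ) : ℝ) • (B ^ j) (x i)
    have hc : ∀ s, (B ^ j) (X s) = c (e s).2 + ((((e s).1 : ℤˣ) : ℤ) : ℝ) • x 0 := by
      intro s
      simp only [hX, map_sum, map_smul]
      rw [Fintype.sum_eq_add_sum_subtype_ne _ j', add_comm]
      congr 2
      exact hxpow j
    have h1 := condEnt_step h c (x 0)
    have hcard : (2 : ℝ) * Fintype.card ({i // i ≠ j'} → ℤˣ) = 2 ^ n := by
      have := Fintype.card_congr e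
      rw [card_signs, Fintype.card_prod, Fintype.card_units_int] at this
      exact_mod_cast this.symm
    rw [hcard, ← condEnt_equiv e, ← condEnt_equiv e] at h1
    have hK : K j = condEnt fun (s : Fin n → ℤˣ) (z : E) =>
        gauss (z - (c (e s).2 + ((((e s).1 : ℤˣ) : ℤ) : ℝ) • x 0)) := by
      simp only [K, hc]
    have hK' : K (j + 1) = condEnt fun (s : Fin n → ℤˣ) (z : E) =>
        gauss (z - B (c (e s).2 + ((((e s).1 : ℤˣ) : ℤ) : ℝ) • x 0)) := by
      simp only [K, pow_succ', Module.End.mul_apply, hc]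
    rw [hK, hK']
    exact h1
  have htel : ∀ j ≤ n, K 0 + j * (2 ^ n * Γ * D) ≤ K j := by
    intro j
    induction j with
    | zero => simp
    | succ j ih =>
      intro hj
      have h1 := ih (by omega)
      have h2 := hstep j (by omega)
      push_cast
      linarith
  have h1 := htel n le_rfl
  have h2 : Γ * ∑ s, Real.log (fiberCard X s) ≤ K 0 := by
    have := le_condEnt (X := X) (g := fun c (z : E) => gauss (z - c)) fun s => gauss_isNice _
    simp only [integral_gauss_sub] at this
    rw [Finset.mul_sum]
    simpa only [K, pow_zero, Module.End.one_apply] using this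
  have h3 : K n ≤ 2 ^ n * Γ * (n * Real.log 2) := by
    have := condEnt_le (f := fun (s : Fin n → ℤˣ) (z : E) => gauss (z - (B ^ n) (X s)))
      fun s => gauss_isNice _
    simp only [integral_gauss_sub, Finset.sum_const, Finset.card_univ, card_signs,
      nsmul_eq_mul] at this
    push_cast at this
    rwa [Real.log_pow] at this
  have h4 : Γ * (D * n * 2 ^ n) ≤ Γ * (n * 2 ^ n * Real.log 2 -
      ∑ s, Real.log (fiberCard X s)) := by linarith
  exact le_of_mul_le_mul_left h4 hΓ

/-! ### The Euclidean norm attached to an observable -/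

section Observability

variable {V : Type*} [AddCommGroup V] [Module ℝ V]

/-- The inner product `∑ ℓ(B^k x) ℓ(B^k y)` attached to an observable `ℓ` of a linear system. -/
@[reducible]
def observabilityCore (B : V →ₗ[ℝ] V) (ℓ : V →ₗ[ℝ] ℝ)
    (hsum : ∀ x, Summable fun k => (ℓ ((B ^ k) x)) ^ 2)
    (hinj : ∀ x, (∀ k, ℓ ((B ^ k) x) = 0) → x = 0) : InnerProductSpace.Core ℝ V :=
  have hs : ∀ x y, Summable fun k => ℓ ((B ^ k) x) * ℓ ((B ^ k) y) := fun x y => by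
    refine Summable.of_norm_bounded ((hsum x).add (hsum y)) fun k => ?_
    rw [Real.norm_eq_abs, abs_le]
    constructor <;>
      nlinarith [sq_nonneg (ℓ ((B ^ k) x) + ℓ ((B ^ k) y)), sq_nonneg (ℓ ((B ^ k) x) - ℓ ((B ^ k) y)),
        sq_nonneg (ℓ ((B ^ k) x)), sq_nonneg (ℓ ((B ^ k) y))]
  { inner := fun x y => ∑' k, ℓ ((B ^ k) x) * ℓ ((B ^ k) y)
    conj_inner_symm := fun x y => by simp [mul_comm]
    re_inner_nonneg := fun x => by
      simp only [RCLike.re_to_real]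
      exact tsum_nonneg fun k => mul_self_nonneg _
    add_left := fun x y z => by
      simp only [map_add, add_mul]
      exact (hs x z).tsum_add (hs y z)
    smul_left := fun x y r => by
      simp only [map_smul, smul_eq_mul, mul_assoc, tsum_mul_left, conj_trivial]
    definite := fun x hx => hinj x fun k => by
      have h1 := hs x x
      have h2 := (hasSum_zero_iff_of_nonneg (f := fun k => ℓ ((B ^ k) x) * ℓ ((B ^ k) x))
        fun k => mul_self_nonneg _).mp (hx ▸ h1.hasSum)
      exact mul_self_eq_zero.mp (congrFun h2 k) }

/-- In the norm `∑ ℓ(B^k x)²`, applying `B` drops exactly the term `k = 0`, so `B` is a rank one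
contraction whose vector `u` represents `ℓ`. -/
theorem exists_entropy_bound_of_observable [FiniteDimensional ℝ V] {B : V →ₗ[ℝ] V}
    {ℓ : V →ₗ[ℝ] ℝ}
    (hdet0 : LinearMap.det B ≠ 0) (hdet1 : |LinearMap.det B| < 1)
    (hsum : ∀ x, Summable fun k => (ℓ ((B ^ k) x)) ^ 2)
    (hinj : ∀ x, (∀ k, ℓ ((B ^ k) x) = 0) → x = 0) {t : ℝ} (ht : 0 ≤ t) :
    ∃ v : V, ∀ x : ℕ → V, x 0 = v → (∀ i, B (x (i + 1)) = x i) → ∀ n : ℕ,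
      (errEnt (|LinearMap.det B| * t) - errEnt t) * n * 2 ^ n ≤ n * 2 ^ n * Real.log 2 -
      ∑ s, Real.log (fiberCard
        (fun s : Fin n → ℤˣ => ∑ i : Fin n, (((s i : ℤˣ) : ℤ) : ℝ) • x i) s) := by
  let core := observabilityCore B ℓ hsum hinj
  let _ : NormedAddCommGroup V := core.toNormedAddCommGroup
  let _ : InnerProductSpace ℝ V := InnerProductSpace.ofCore core.toCore
  let _ : MeasurableSpace V := borel V
  have : BorelSpace V := ⟨rfl⟩
  have hnorm : ∀ x : V, ‖x‖ ^ 2 = ∑' k, (ℓ ((B ^ k) x)) ^ 2 := by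
    intro x
    rw [← real_inner_self_eq_norm_sq]
    simp only [sq]
    rfl
  let L : StrongDual ℝ V := LinearMap.toContinuousLinearMap ℓ
  let u : V := (InnerProductSpace.toDual ℝ V).symm L
  have hu : ∀ z, inner ℝ u z = ℓ z := fun z => InnerProductSpace.toDual_symm_apply
  have hB : IsRankOneContraction B u := by
    refine ⟨fun z => ?_, hdet0⟩
    rw [hnorm, hnorm, hu, (hsum z).tsum_eq_zero_add]
    simp only [pow_zero, Module.End.one_apply, pow_succ, Module.End.mul_apply]
    ring
  -- For `u = 0` the map would be an isometry, of determinant `±1`.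
  have hu0 : u ≠ 0 := by
    intro h0
    rw [hB.abs_det, h0] at hdet1
    simp at hdet1
  refine ⟨(t / ‖u‖) • u, fun x hx0 hx n => ?_⟩
  have h1 := gaussian_entropy_bound hB hx n
  have h2 : ‖x 0‖ = t := by
    rw [hx0, norm_smul, norm_div, norm_norm, div_mul_cancel₀ _ (norm_ne_zero_iff.mpr hu0),
      Real.norm_of_nonneg ht]
  have h3 : ‖B (x 0)‖ = |LinearMap.det B| * t := by
    rw [hx0, hB.norm_apply_smul, ← hx0, h2]
  rw [h2, h3] at h1
  exact h1

end Observability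

/-! ### Linear recurrences whose shift inverts the expanding part -/

section Shift

variable {K : Type*} [Field K]

variable (K) in
/-- The left shift on sequences. -/
def shift : (ℕ → K) →ₗ[K] (ℕ → K) where
  toFun x n := x (n + 1)
  map_add' _ _ := rfl
  map_smul' _ _ := rfl

theorem shift_apply (x : ℕ → K) (n : ℕ) : shift K x n = x (n + 1) := rfl

theorem shift_pow_apply (x : ℕ → K) (k n : ℕ) : (shift K ^ k) x n = x (n + k) := by
  induction k generalizing n with
  | zero => simp
  | succ k ih => rw [pow_succ', Module.End.mul_apply, shift_apply, ih]; congr 1; ring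

theorem aeval_shift_apply (p : K[X]) (x : ℕ → K) (n : ℕ) :
    aeval (shift K) p x n = ∑ i ∈ Finset.range (p.natDegree + 1), p.coeff i * x (n + i) := by
  rw [aeval_eq_sum_range, LinearMap.sum_apply, Finset.sum_apply]
  refine Finset.sum_congr rfl fun i _ => ?_
  rw [LinearMap.smul_apply, Pi.smul_apply, shift_pow_apply, smul_eq_mul]

end Shift

/-- The relation reads `‖a‖ ‖x (n + 1)‖ ≤ ‖x n‖ + error`, a contraction on partial sums. Removing
one root at a time in this way handles repeated roots without diagonalization. -/
theorem summable_of_sub_shift {a : ℂ} (ha : 1 < ‖a‖) {x : ℕ → ℂ}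
    (h : Summable fun n => ‖x n - a * x (n + 1)‖) : Summable fun n => ‖x n‖ := by
  set Y := ∑' n, ‖x n - a * x (n + 1)‖ with hY
  have ha0 : 0 < ‖a‖ := one_pos.trans ha
  -- The fixed point of the recursive bound: `‖a‖ * C = C + ‖a‖ * ‖x 0‖ + Y`.
  set C := (‖a‖ * ‖x 0‖ + Y) / (‖a‖ - 1) with hC
  have ha1 : 0 < ‖a‖ - 1 := by linarith
  have hC' : C * (‖a‖ - 1) = ‖a‖ * ‖x 0‖ + Y := div_mul_cancel₀ _ ha1.ne'
  have hY0 : 0 ≤ Y := tsum_nonneg fun n => norm_nonneg _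
  have key : ∀ N, ∑ n ∈ Finset.range N, ‖x n‖ ≤ C := by
    intro N
    induction N with
    | zero => simp only [Finset.range_zero, Finset.sum_empty]; positivity
    | succ N ih =>
      rw [Finset.sum_range_succ']
      have h1 : ∀ n, ‖a‖ * ‖x (n + 1)‖ ≤ ‖x n‖ + ‖x n - a * x (n + 1)‖ := by
        intro n
        rw [← norm_mul]
        have := norm_sub_le (x n) (x n - a * x (n + 1))
        rwa [sub_sub_cancel] at this
      have h2 := Finset.sum_le_sum fun n (_ : n ∈ Finset.range N) => h1 n
      rw [← Finset.mul_sum, Finset.sum_add_distrib] at h2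
      have h3 := h.sum_le_tsum (Finset.range N) fun n _ => norm_nonneg _
      have h4 : ‖a‖ * (∑ n ∈ Finset.range N, ‖x (n + 1)‖ + ‖x 0‖) ≤ ‖a‖ * C := by linarith
      exact le_of_mul_le_mul_left h4 ha0
  exact summable_of_sum_range_le (fun n => norm_nonneg _) key

theorem summable_of_aeval_shift (s : Multiset ℂ) (hs : ∀ a ∈ s, 1 < ‖a‖) (x : ℕ → ℂ)
    (h : Summable fun n => ‖aeval (shift ℂ) (s.map fun a => 1 - C a * X).prod x n‖) :
    Summable fun n => ‖x n‖ := by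
  induction s using Multiset.induction_on generalizing x with
  | empty => simpa using h
  | cons a s ih =>
    rw [Multiset.map_cons, Multiset.prod_cons, mul_comm, map_mul] at h
    have h1 := ih (fun b hb => hs b (Multiset.mem_cons_of_mem hb)) _ h
    refine summable_of_sub_shift (hs a (Multiset.mem_cons_self a s)) (h1.congr fun n => ?_)
    simp [shift_apply]

/-- The determinant of a companion matrix, up to sign. -/
theorem abs_det_companion {m : ℕ} (c : Fin (m + 1) → ℝ) :
    |Matrix.det (Matrix.of fun i j : Fin (m + 1) =>
      if (i : ℕ) < m then (if (j : ℕ) = i + 1 then 1 else 0) else c j)| = |c 0| := by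
  rw [Matrix.det_succ_column_zero, Finset.sum_eq_single (Fin.last m)]
  · have : (Matrix.of fun i j : Fin (m + 1) =>
        if (i : ℕ) < m then (if (j : ℕ) = i + 1 then (1 : ℝ) else 0) else c j).submatrix
        (Fin.last m).succAbove Fin.succ = 1 := by
      ext i j
      simp [Matrix.one_apply, Fin.ext_iff, eq_comm]
    rw [this]
    simp [abs_mul]
  · intro i _ hi
    have : (i : ℕ) < m := by
      have := i.2
      have h2 : (i : ℕ) ≠ m := fun h => hi (Fin.ext h)
      omega
    simp [this]
  · simp

theorem reverse_X_sub_C {K : Type*} [Field K] (a : K) : (X - C a).reverse = 1 - C a * X := by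
  rw [reverse, natDegree_X_sub_C, reflect_sub, reflect_one_X, reflect_C, pow_one]

theorem reverse_prod_X_sub_C {K : Type*} [Field K] (s : Multiset K) :
    (s.map fun a => X - C a).prod.reverse = (s.map fun a => 1 - C a * X).prod := by
  induction s using Multiset.induction_on with
  | empty => simpa using reverse_C (1 : K)
  | cons a s ih =>
    rw [Multiset.map_cons, Multiset.prod_cons, reverse_mul_of_domain, ih, reverse_X_sub_C,
      Multiset.map_cons, Multiset.prod_cons]

theorem natDegree_reverse_of_coeff_zero_ne {K : Type*} [Field K] {P : K[X]} (h : P.coeff 0 ≠ 0) :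
    P.reverse.natDegree = P.natDegree := by
  rw [reverse_natDegree, natTrailingDegree_eq_zero.mpr (Or.inr h), Nat.sub_zero]

/-- If `B * A = 1` then the reverse of `P` vanishes at `B` only if `P` vanishes at `A`. -/
theorem pow_mul_aeval_eq_aeval_reverse {K R : Type*} [Field K] [Ring R] [Algebra K R] {A B : R}
    (h : B * A = 1) {P : K[X]} (hP : P.coeff 0 ≠ 0) :
    B ^ P.natDegree * aeval A P = aeval B P.reverse := by
  have hpow : ∀ j, B ^ j * A ^ j = 1 := by
    intro j
    induction j with
    | zero => simp
    | succ j ih => rw [pow_succ, pow_succ', mul_assoc, ← mul_assoc B, h, one_mul, ih]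
  rw [aeval_eq_sum_range, aeval_eq_sum_range, natDegree_reverse_of_coeff_zero_ne hP,
    ← Finset.sum_range_reflect, Finset.mul_sum]
  refine Finset.sum_congr rfl fun i hi => ?_
  have hi' : i ≤ P.natDegree := by simpa [Nat.lt_succ_iff] using hi
  rw [coeff_reverse, revAt_le hi', mul_smul_comm, Nat.add_sub_cancel]
  congr 1
  conv_lhs => rw [← Nat.add_sub_cancel' hi', pow_add, mul_assoc, Nat.add_sub_cancel_left, hpow,
    mul_one]

theorem sum_smul_eq_of_aeval_halfDiff {V : Type*} [AddCommGroup V] [Module ℝ V]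
    (A : Module.End ℝ V) {n : ℕ} {a b : Fin n → ℤˣ} (h : aeval A (halfDiff a b) = 0) (v : V) :
    ∑ i : Fin n, (((a i : ℤˣ) : ℤ) : ℝ) • (A ^ (i : ℕ)) v =
      ∑ i : Fin n, (((b i : ℤˣ) : ℤ) : ℝ) • (A ^ (i : ℕ)) v := by
  have h5 := two_mul_aeval_halfDiff a b A
  rw [h, mul_zero, eq_comm, sub_eq_zero] at h5
  have h6 := LinearMap.congr_fun h5 v
  simp only [LinearMap.sum_apply, Module.End.mul_apply, Module.End.intCast_apply] at h6
  simpa only [Int.cast_smul_eq_zsmul] using h6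

/-- The linear recurrence with characteristic polynomial proportional to the reverse of `P`. -/
def reverseRecurrence (P : ℝ[X]) (m : ℕ) : LinearRecurrence ℝ where
  order := m + 1
  coeffs i := -(P.reverse.coeff i) / P.coeff 0

section System

variable {P : ℝ[X]} {m : ℕ}

theorem mem_solSpace_reverseRecurrence (hm : P.natDegree = m + 1) (h0 : P.coeff 0 ≠ 0)
    (x : ℕ → ℝ) :
    x ∈ (reverseRecurrence P m).solSpace ↔ aeval (shift ℝ) P.reverse x = 0 := by
  have hsol : x ∈ (reverseRecurrence P m).solSpace ↔ ∀ n, x (n + (m + 1)) =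
      ∑ i : Fin (m + 1), -(P.reverse.coeff i) / P.coeff 0 * x (n + i) := Iff.rfl
  rw [hsol, funext_iff]
  refine forall_congr' fun n => ?_
  rw [aeval_shift_apply, natDegree_reverse_of_coeff_zero_ne h0, hm, Finset.sum_range_succ,
    coeff_reverse P (m + 1), ← hm, revAt_le le_rfl, Nat.sub_self, hm]
  rw [Pi.zero_apply, ← Finset.sum_range (fun i => -(P.reverse.coeff i) / P.coeff 0 * x (n + i))]
  have : ∑ i ∈ Finset.range (m + 1), -(P.reverse.coeff i) / P.coeff 0 * x (n + i) =
      -(∑ i ∈ Finset.range (m + 1), P.reverse.coeff i * x (n + i)) / P.coeff 0 := by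
    rw [← Finset.sum_neg_distrib, Finset.sum_div]
    exact Finset.sum_congr rfl fun i _ => by ring
  rw [this, eq_div_iff h0]
  constructor <;> intro h <;> linarith

variable (P m) in
/-- The shift on the solutions of the reverse recurrence. -/
def recShift : Module.End ℝ (reverseRecurrence P m).solSpace :=
  (shift ℝ).restrict fun x hx => by
    rw [← LinearRecurrence.is_sol_iff_mem_solSpace] at hx ⊢
    intro n
    have := hx (n + 1)
    simp only [shift_apply]
    rw [add_right_comm, this]
    exact Finset.sum_congr rfl fun i _ => by rw [add_right_comm]

theorem recShift_pow_apply (k n : ℕ) (x : (reverseRecurrence P m).solSpace) :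
    ((recShift P m ^ k) x : ℕ → ℝ) n = (x : ℕ → ℝ) (n + k) := by
  induction k generalizing n with
  | zero => simp
  | succ k ih =>
    rw [pow_succ', Module.End.mul_apply]
    change ((recShift P m ^ k) x : ℕ → ℝ) (n + 1) = _
    rw [ih, add_assoc, add_comm 1 k]

theorem aeval_recShift_apply (p : ℝ[X]) (x : (reverseRecurrence P m).solSpace) (n : ℕ) :
    (aeval (recShift P m) p x : ℕ → ℝ) n = aeval (shift ℝ) p x n := by
  rw [aeval_shift_apply, aeval_eq_sum_range, LinearMap.sum_apply, Submodule.coe_sum,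
    Finset.sum_apply]
  refine Finset.sum_congr rfl fun i _ => ?_
  rw [LinearMap.smul_apply, Submodule.coe_smul, Pi.smul_apply, recShift_pow_apply, smul_eq_mul]

theorem aeval_recShift_reverse (hm : P.natDegree = m + 1) (h0 : P.coeff 0 ≠ 0) :
    aeval (recShift P m) P.reverse = 0 := by
  ext x n
  rw [aeval_recShift_apply, (mem_solSpace_reverseRecurrence hm h0 x).mp x.2]
  rfl

/-- In initial value coordinates the shift is a companion matrix; its corner entry is minus the
leading coefficient of `P`, which is `1`, over `P.coeff 0`. -/
theorem abs_det_recShift (hmonic : P.Monic) :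
    |LinearMap.det (recShift P m)| = |P.coeff 0|⁻¹ := by
  let c : Fin (m + 1) → ℝ := (reverseRecurrence P m).coeffs
  let M : Matrix (Fin (m + 1)) (Fin (m + 1)) ℝ := Matrix.of fun i j =>
    if (i : ℕ) < m then (if (j : ℕ) = i + 1 then 1 else 0) else c j
  let e : (reverseRecurrence P m).solSpace ≃ₗ[ℝ] (Fin (m + 1) → ℝ) :=
    (reverseRecurrence P m).toInit
  have hconj : (e : _ →ₗ[ℝ] _) ∘ₗ recShift P m ∘ₗ (e.symm : _ →ₗ[ℝ] _) = Matrix.toLin' M := by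
    suffices h : ∀ x, e (recShift P m x) = Matrix.toLin' M (e x) by
      refine LinearMap.ext fun y => ?_
      have := h (e.symm y)
      rw [e.apply_symm_apply] at this
      exact this
    intro x
    funext i
    have hx : ∀ j : Fin (m + 1), e x j = (x : ℕ → ℝ) j := fun j => rfl
    have hl : e (recShift P m x) i = (x : ℕ → ℝ) (i + 1) := rfl
    rw [hl, Matrix.toLin'_apply, Matrix.mulVec, dotProduct]
    simp only [M, Matrix.of_apply, hx]
    by_cases hi : (i : ℕ) < m
    · simp only [hi, if_true]
      rw [Finset.sum_eq_single ⟨i + 1, by omega⟩]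
      · simp
      · intro j _ hj
        have : (j : ℕ) ≠ i + 1 := fun h => hj (Fin.ext h)
        simp [this]
      · simp
    · have him : (i : ℕ) = m := by have := i.2; omega
      simp only [him, lt_irrefl, if_false]
      have := x.2 0
      simp only [zero_add] at this
      exact this
  rw [← LinearMap.det_conj (recShift P m) e, hconj, LinearMap.det_toLin', abs_det_companion c]
  simp only [c, reverseRecurrence, Fin.val_zero, coeff_zero_reverse, hmonic.leadingCoeff]
  rw [abs_div, abs_neg, abs_one, one_div]

/-- The characteristic roots of the reversed recurrence are the inverses of the `a ∈ s`, so
solutions decay. This makes evaluation at `0` an admissible observable. -/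
theorem summable_solution_sq {s : Multiset ℂ} (hs : ∀ a ∈ s, 1 < ‖a‖)
    (hP : P.map (algebraMap ℝ ℂ) = (s.map fun a => X - C a).prod)
    (hm : P.natDegree = m + 1) (h0 : P.coeff 0 ≠ 0)
    (x : (reverseRecurrence P m).solSpace) : Summable fun k => (x : ℕ → ℝ) k ^ 2 := by
  have hx := (mem_solSpace_reverseRecurrence hm h0 x).mp x.2
  have hinj : Function.Injective (algebraMap ℝ ℂ) := (algebraMap ℝ ℂ).injective
  have hrev : (s.map fun a => 1 - C a * X).prod = P.reverse.map (algebraMap ℝ ℂ) := by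
    rw [← reverse_prod_X_sub_C, ← hP, reverse, reverse, natDegree_map_eq_of_injective hinj,
      reflect_map]
  have h1 : aeval (shift ℂ) (s.map fun a => 1 - C a * X).prod (fun n => ((x : ℕ → ℝ) n : ℂ)) = 0 := by
    funext n
    rw [hrev, aeval_shift_apply, natDegree_map_eq_of_injective hinj]
    have := congrFun hx n
    rw [aeval_shift_apply] at this
    have h2 := congrArg (algebraMap ℝ ℂ) this
    simpa using h2
  have h2 := summable_of_aeval_shift s hs (fun n => ((x : ℕ → ℝ) n : ℂ)) (by
    rw [h1]
    simp)
  simp only [Complex.norm_real, Real.norm_eq_abs] at h2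
  have h3 : ∀ᶠ n in atTop, |(x : ℕ → ℝ) n| ≤ 1 :=
    h2.tendsto_atTop_zero.eventually (ge_mem_nhds one_pos)
  refine Summable.of_norm_bounded_eventually_nat h2 ?_
  filter_upwards [h3] with n hn
  rw [Real.norm_of_nonneg (sq_nonneg _), ← sq_abs]
  nlinarith [abs_nonneg ((x : ℕ → ℝ) n)]

/-- Lower bound for the entropy of sums in which the sign vectors are identified only modulo an
expanding polynomial `P`. -/
theorem entropy_bound_of_expanding {s : Multiset ℂ} (hs : ∀ a ∈ s, 1 < ‖a‖)
    (hP : P.map (algebraMap ℝ ℂ) = (s.map fun a => X - C a).prod) (hmonic : P.Monic)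
    (h1 : 1 < |P.coeff 0|) {t : ℝ} (ht : 0 ≤ t) {n : ℕ} {β : Type*} {f : (Fin n → ℤˣ) → β}
    (hf : ∀ a b, f a = f b → P ∣ (halfDiff a b).map (algebraMap ℤ ℝ)) :
    (errEnt (|P.coeff 0|⁻¹ * t) - errEnt t) * n * 2 ^ n ≤ n * 2 ^ n * Real.log 2 -
      ∑ a, Real.log (fiberCard f a) := by
  have h0 : P.coeff 0 ≠ 0 := abs_pos.mp (one_pos.trans h1)
  obtain ⟨m, hm⟩ : ∃ m, P.natDegree = m + 1 := by
    refine Nat.exists_eq_succ_of_ne_zero fun hd => ?_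
    rw [hmonic.natDegree_eq_zero.mp hd] at h1
    simp at h1
  have hdet := abs_det_recShift (m := m) hmonic
  have hdet1 : |LinearMap.det (recShift P m)| < 1 := by rw [hdet]; exact inv_lt_one_of_one_lt₀ h1
  have hdet0 : LinearMap.det (recShift P m) ≠ 0 := by
    rw [← abs_pos, hdet]; positivity
  -- With `ℓ` the evaluation at `0`, the observations `ℓ (B^k x)` are the terms of the sequence `x`
  -- itself, so the norm is that of `ℓ²` and separation of points is automatic.
  let ℓ : (reverseRecurrence P m).solSpace →ₗ[ℝ] ℝ :=
    (LinearMap.proj 0 : (ℕ → ℝ) →ₗ[ℝ] ℝ) ∘ₗ Submodule.subtype _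
  have hℓ : ∀ x k, ℓ ((recShift P m ^ k) x) = (x : ℕ → ℝ) k := by
    intro x k
    have := recShift_pow_apply k 0 x
    rw [zero_add] at this
    exact this
  have hfin : FiniteDimensional ℝ (reverseRecurrence P m).solSpace :=
    (reverseRecurrence P m).basis.finiteDimensional_of_finite
  obtain ⟨v, hv⟩ := exists_entropy_bound_of_observable (ℓ := ℓ) hdet0 hdet1
    (fun x => by simp only [hℓ]; exact summable_solution_sq hs hP hm h0 x)
    (fun x hx => by
      refine Subtype.ext (funext fun k => ?_)
      have := hx k
      rw [hℓ] at this
      exact this) ht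
  obtain ⟨U, hU⟩ : IsUnit (recShift P m) :=
    (LinearMap.isUnit_iff_isUnit_det _).mpr (isUnit_iff_ne_zero.mpr hdet0)
  set A : Module.End ℝ (reverseRecurrence P m).solSpace :=
    ((U⁻¹ : Units _) : Module.End ℝ (reverseRecurrence P m).solSpace) with hA
  have hBA : recShift P m * A = 1 := by rw [← hU, hA, Units.mul_inv]
  have hPA : aeval A P = 0 := by
    have h2 := pow_mul_aeval_eq_aeval_reverse
      (R := Module.End ℝ (reverseRecurrence P m).solSpace) hBA h0
    rw [aeval_recShift_reverse hm h0, ← hU] at h2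
    exact (IsUnit.mul_right_eq_zero (U.isUnit.pow _)).mp h2
  have h2 := hv (fun i => (A ^ i) v) (by simp) (fun i => by
    rw [pow_succ', Module.End.mul_apply, ← Module.End.mul_apply, hBA, Module.End.one_apply]) n
  rw [hdet] at h2
  -- A collision of `f` forces a collision of the vector sums, since `P(A) = 0`; so the fibres of
  -- `f` are the smaller ones.
  refine h2.trans (sub_le_sub_left (Finset.sum_le_sum fun a _ => ?_) _)
  refine Real.log_le_log (by exact_mod_cast fiberCard_pos f a) ?_
  have h3 : ∀ a b, f a = f b → ∑ i : Fin n, (((a i : ℤˣ) : ℤ) : ℝ) • (A ^ (i : ℕ)) v =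
      ∑ i : Fin n, (((b i : ℤˣ) : ℤ) : ℝ) • (A ^ (i : ℕ)) v := by
    intro a b hab
    obtain ⟨Q, hQ⟩ := hf a b hab
    have h4 : aeval A (halfDiff a b) = 0 := by
      rw [← aeval_map_algebraMap ℝ, hQ, map_mul, hPA, zero_mul]
    exact sum_smul_eq_of_aeval_halfDiff A h4 v
  exact Nat.cast_le.mpr (fiberCard_le_of_imp h3 a)

end System

/-! ### The expanding factor of the minimal polynomial -/

/-- The conjugates outside the closed unit disc. -/
def expandingRoots (z : ℂ) : Multiset ℂ := (conjRoots z).filter fun w => 1 < ‖w‖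

theorem map_conj_expandingRoots (z : ℂ) :
    (expandingRoots z).map (starRingEnd ℂ) = expandingRoots z := by
  rw [expandingRoots]
  nth_rw 2 [← map_conj_conjRoots]
  rw [Multiset.filter_map]
  congr 1
  refine Multiset.filter_congr fun w _ => ?_
  simp

/-- The expanding roots are stable under conjugation with multiplicity, so their monic polynomial
has real coefficients. -/
theorem exists_expandingPoly (z : ℂ) : ∃ P : ℝ[X], P.Monic ∧
    P.map (algebraMap ℝ ℂ) = ((expandingRoots z).map fun a => X - C a).prod := by
  set q := ((expandingRoots z).map fun a => X - C a).prod with hq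
  have hmonic : q.Monic := monic_multiset_prod_of_monic _ _ fun a _ => monic_X_sub_C a
  have hconj : q.map (starRingEnd ℂ) = q := by
    conv_rhs => rw [hq, ← map_conj_expandingRoots]
    rw [hq, Polynomial.map_multiset_prod, Multiset.map_map, Multiset.map_map]
    congr 2
    ext a : 1
    simp
  have hlift : q ∈ lifts (algebraMap ℝ ℂ) := by
    rw [lifts_iff_coeff_lifts]
    intro n
    have h1 : starRingEnd ℂ (q.coeff n) = q.coeff n := by
      rw [← coeff_map, hconj]
    obtain ⟨r, hr⟩ := Complex.conj_eq_iff_real.mp h1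
    exact ⟨r, hr.symm⟩
  obtain ⟨P, hP, -, hPm⟩ := lifts_and_natDegree_eq_and_monic hlift hmonic
  exact ⟨P, hPm, hP⟩

theorem entropy_bound_of_mahler {z : ℂ} (hz : IsAlgebraic ℚ z)
    (hu : IsUnit (intMinpoly z).leadingCoeff) (hM : 1 < mahler z) {t : ℝ} (ht : 0 ≤ t) (n : ℕ) :
    (errEnt ((mahler z)⁻¹ * t) - errEnt t) * n * 2 ^ n ≤ n * 2 ^ n * Real.log 2 -
      ∑ a, Real.log (fiberCard (signedSum z n) a) := by
  obtain ⟨P, hPm, hP⟩ := exists_expandingPoly z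
  have hcoeff : |P.coeff 0| = mahler z := by
    have h1 : |((intMinpoly z).leadingCoeff : ℝ)| = 1 := by
      rw [Int.isUnit_iff] at hu
      rcases hu with h | h <;> simp [h]
    have h2 : ((P.coeff 0 : ℝ) : ℂ) = ((expandingRoots z).map fun a => -a).prod := by
      have h3 : (P.map (algebraMap ℝ ℂ)).coeff 0 = ((P.coeff 0 : ℝ) : ℂ) := coeff_map _ _
      rw [← h3, hP, coeff_zero_eq_eval_zero, eval_multiset_prod, Multiset.map_map]
      congr 2
      ext a
      simp
    have h4 := congrArg norm h2
    rw [Complex.norm_real, Real.norm_eq_abs] at h4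
    rw [h4, mahler_eq, h1, one_mul]
    have h5 : ∀ s : Multiset ℂ, ‖(s.map fun a => -a).prod‖ = (s.map fun w => ‖w‖).prod := by
      intro s
      induction s using Multiset.induction_on with
      | empty => simp
      | cons a s ih =>
        rw [Multiset.map_cons, Multiset.prod_cons, Multiset.map_cons, Multiset.prod_cons, norm_mul, ih,
          norm_neg]
    exact h5 _
  rw [← hcoeff]
  refine entropy_bound_of_expanding (s := expandingRoots z)
    (fun a ha => (Multiset.mem_filter.mp ha).2) hP hPm (by rwa [hcoeff]) ht fun a b hab => ?_
  have hdvd : P ∣ (intMinpoly z).map (algebraMap ℤ ℝ) := by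
    rw [← map_dvd_map' (algebraMap ℝ ℂ), hP, Polynomial.map_map]
    have h1 : (algebraMap ℝ ℂ).comp (algebraMap ℤ ℝ) = Int.castRingHom ℂ := Subsingleton.elim _ _
    rw [h1]
    refine dvd_trans ?_ (prod_multiset_X_sub_C_dvd _)
    exact Multiset.prod_dvd_prod_of_le (Multiset.map_le_map (Multiset.filter_le _ _))
  exact hdvd.trans ((Polynomial.mapRingHom (algebraMap ℤ ℝ)).map_dvd
    (intMinpoly_dvd_halfDiff hz hab))

/-! ### The derivative of `errEnt` and the mean square error -/

theorem gaussianPDFReal_std (x : ℝ) :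
    gaussianPDFReal 0 1 x = (√(2 * Real.pi))⁻¹ * Real.exp (-x ^ 2 / 2) := by
  simp [gaussianPDFReal]

theorem integral_gaussianReal_std (f : ℝ → ℝ) :
    ∫ x, f x ∂(gaussianReal 0 1) = ∫ x, gaussianPDFReal 0 1 x * f x :=
  integral_gaussianReal_eq_integral_smul one_ne_zero

theorem hasDerivAt_gaussianPDFReal_std (x : ℝ) :
    HasDerivAt (gaussianPDFReal 0 1) (-(x * gaussianPDFReal 0 1 x)) x := by
  rw [funext gaussianPDFReal_std]
  have h := (((hasDerivAt_pow 2 x).neg.div_const 2).exp).const_mul (√(2 * Real.pi))⁻¹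
  refine h.congr_deriv ?_
  simp
  ring

theorem integrable_abs_gaussianReal : Integrable (fun x : ℝ => |x|) (gaussianReal 0 1) :=
  ((memLp_id_gaussianReal 1).integrable (by norm_num)).norm

theorem integrable_gaussianReal_iff {f : ℝ → ℝ} :
    Integrable f (gaussianReal 0 1) ↔ Integrable fun x => gaussianPDFReal 0 1 x * f x := by
  rw [gaussianReal_of_var_ne_zero _ one_ne_zero,
    integrable_withDensity_iff_integrable_smul' (measurable_gaussianPDF _ _)
      (ae_of_all _ fun _ => gaussianPDF_lt_top)]
  simp [gaussianPDF, ENNReal.toReal_ofReal (gaussianPDFReal_nonneg _ _ _)]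

theorem integrable_gaussianReal_of_bdd {f : ℝ → ℝ} (hf : Continuous f) {C : ℝ}
    (hC : ∀ x, |f x| ≤ C) : Integrable f (gaussianReal 0 1) :=
  Integrable.of_bound hf.aestronglyMeasurable C (ae_of_all _ fun x => hC x)

/-- Gaussian integration by parts. -/
theorem integral_id_mul_gaussianReal {g g' : ℝ → ℝ} (hg : ∀ x, HasDerivAt g (g' x) x)
    (hg' : Continuous g') {C C' : ℝ} (hC : ∀ x, |g x| ≤ C) (hC' : ∀ x, |g' x| ≤ C') :
    ∫ x, x * g x ∂(gaussianReal 0 1) = ∫ x, g' x ∂(gaussianReal 0 1) := by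
  have hgc : Continuous g := continuous_iff_continuousAt.mpr fun x => (hg x).continuousAt
  have h1 : Integrable (fun x => x * g x) (gaussianReal 0 1) := by
    refine (integrable_abs_gaussianReal.mul_const C).mono'
      (Continuous.aestronglyMeasurable (by fun_prop)) (ae_of_all _ fun x => ?_)
    rw [norm_mul, Real.norm_eq_abs]
    exact mul_le_mul_of_nonneg_left (hC x) (abs_nonneg x)
  have h2 := integrable_gaussianReal_of_bdd hgc hC
  have h3 := integrable_gaussianReal_of_bdd hg' hC'
  rw [integrable_gaussianReal_iff] at h1 h2 h3
  have := integral_mul_deriv_eq_deriv_mul_of_integrable (u := g) (u' := g')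
    (v := gaussianPDFReal 0 1) (v' := fun x => -(x * gaussianPDFReal 0 1 x)) (fun x _ => hg x)
    (fun x _ => hasDerivAt_gaussianPDFReal_std x)
    (h1.neg.congr (ae_of_all _ fun x => by simp only [Pi.neg_apply, Pi.mul_apply]; ring))
    (h3.congr (ae_of_all _ fun x => by simp only [Pi.mul_apply]; ring))
    (h2.congr (ae_of_all _ fun x => by simp only [Pi.mul_apply]; ring))
  rw [integral_gaussianReal_std, integral_gaussianReal_std, ← neg_inj, ← integral_neg]
  have e1 : ∫ x, -(gaussianPDFReal 0 1 x * (x * g x)) =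
      ∫ x, g x * -(x * gaussianPDFReal 0 1 x) :=
    integral_congr_ae (ae_of_all _ fun x => by ring)
  have e2 : ∫ x, gaussianPDFReal 0 1 x * g' x = ∫ x, g' x * gaussianPDFReal 0 1 x :=
    integral_congr_ae (ae_of_all _ fun x => by ring)
  rw [e1, e2, this]

/-- The Cameron-Martin formula on the real line. -/
theorem integral_add_gaussianReal (h : ℝ → ℝ) (s : ℝ) :
    ∫ x, h (x + s) ∂(gaussianReal 0 1) =
      Real.exp (-s ^ 2 / 2) * ∫ x, Real.exp (s * x) * h x ∂(gaussianReal 0 1) := by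
  rw [integral_gaussianReal_std, integral_gaussianReal_std,
    ← integral_sub_right_eq_self _ s, ← integral_const_mul]
  refine integral_congr_ae (ae_of_all _ fun x => ?_)
  simp only [sub_add_cancel, gaussianPDFReal_std]
  have : Real.exp (-(x - s) ^ 2 / 2) =
      Real.exp (-x ^ 2 / 2) * Real.exp (s * x) * Real.exp (-s ^ 2 / 2) := by
    rw [← Real.exp_add, ← Real.exp_add]
    congr 1
    ring
  rw [this]
  ring

theorem integral_comp_neg_gaussianReal (f : ℝ → ℝ) :
    ∫ x, f (-x) ∂(gaussianReal 0 1) = ∫ x, f x ∂(gaussianReal 0 1) := by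
  rw [integral_gaussianReal_std, integral_gaussianReal_std, ← integral_neg_eq_self]
  refine integral_congr_ae (ae_of_all _ fun x => ?_)
  simp only [neg_neg, gaussianPDFReal_std, neg_sq]

/-- The logistic weight `1 - tanh y`. -/
def logistic (y : ℝ) : ℝ := 2 / (1 + Real.exp (2 * y))

theorem logistic_pos (y : ℝ) : 0 < logistic y := by unfold logistic; positivity

theorem logistic_le (y : ℝ) : logistic y ≤ 2 := by
  unfold logistic
  rw [div_le_iff₀ (by positivity)]
  linarith [Real.exp_pos (2 * y)]

theorem continuous_logistic : Continuous logistic := by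
  unfold logistic
  exact continuous_const.div (by fun_prop) fun y => by positivity

theorem logistic_add_neg (y : ℝ) : logistic y + logistic (-y) = 2 := by
  unfold logistic
  rw [mul_neg, Real.exp_neg]
  have := Real.exp_pos (2 * y)
  field_simp
  ring

theorem exp_mul_logistic (y : ℝ) : Real.exp y * logistic y = (Real.cosh y)⁻¹ := by
  unfold logistic
  rw [Real.cosh_eq, Real.exp_neg, two_mul, Real.exp_add]
  have := Real.exp_pos y
  field_simp
  ring

theorem hasDerivAt_logistic (y : ℝ) :
    HasDerivAt logistic (-(logistic y * (2 - logistic y))) y := by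
  have h0 : 1 + Real.exp (2 * y) ≠ 0 := by positivity
  have h1 : HasDerivAt (fun y : ℝ => 2 * y) 2 y := by
    simpa using (hasDerivAt_id y).const_mul 2
  have h2 := (hasDerivAt_const y (2 : ℝ)).div (h1.exp.const_add 1) h0
  refine h2.congr_deriv ?_
  unfold logistic
  field_simp
  ring

/-- The minimal mean square error of estimating a fair sign at signal strength `s`. -/
def mmse (s : ℝ) : ℝ :=
  Real.exp (-s ^ 2 / 2) * ∫ x, (Real.cosh (s * x))⁻¹ ∂(gaussianReal 0 1)

theorem abs_inv_cosh_le (y : ℝ) : |(Real.cosh y)⁻¹| ≤ 1 := by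
  rw [abs_of_pos (inv_pos.mpr (Real.cosh_pos y))]
  exact inv_le_one_of_one_le₀ (Real.one_le_cosh y)

theorem continuous_inv_cosh (s : ℝ) : Continuous fun x => (Real.cosh (s * x))⁻¹ :=
  Continuous.inv₀ (by fun_prop) fun x => (Real.cosh_pos _).ne'

theorem integrable_inv_cosh (s : ℝ) :
    Integrable (fun x => (Real.cosh (s * x))⁻¹) (gaussianReal 0 1) :=
  integrable_gaussianReal_of_bdd (continuous_inv_cosh s) fun _ => abs_inv_cosh_le _

/-- The left side is the mean square error of the optimal estimator `tanh`, given that the sign is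
`1`. A Cameron-Martin shift brings in `exp (s * x)`, which turns one factor `logistic` into the even
function `1 / cosh`. -/
theorem integral_logistic_sq (s : ℝ) :
    ∫ x, logistic (s * x + s ^ 2) ^ 2 ∂(gaussianReal 0 1) = mmse s := by
  have h1 := integral_add_gaussianReal (fun x => logistic (s * x) ^ 2) s
  simp only [mul_add, ← sq] at h1
  rw [h1, mmse]
  congr 1
  have h2 : ∀ x, Real.exp (s * x) * logistic (s * x) ^ 2 =
      (Real.cosh (s * x))⁻¹ * logistic (s * x) := fun x => by
    rw [← exp_mul_logistic]; ring
  simp_rw [h2]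
  have hint : Integrable (fun x => (Real.cosh (s * x))⁻¹ * logistic (s * x)) (gaussianReal 0 1) := by
    refine integrable_gaussianReal_of_bdd (C := 1 * 2)
      ((continuous_inv_cosh s).mul (continuous_logistic.comp (by fun_prop))) fun x => ?_
    rw [abs_mul, abs_of_pos (logistic_pos _)]
    exact mul_le_mul (abs_inv_cosh_le _) (logistic_le _) (logistic_pos _).le zero_le_one
  -- Symmetrizing under `x ↦ -x` replaces the remaining factor `logistic` by its mean `1`.
  have h3 := integral_comp_neg_gaussianReal (fun x => (Real.cosh (s * x))⁻¹ * logistic (s * x))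
  have hint' : Integrable (fun x => (Real.cosh (s * -x))⁻¹ * logistic (s * -x))
      (gaussianReal 0 1) := by
    refine integrable_gaussianReal_of_bdd (C := 1 * 2)
      (((continuous_inv_cosh s).comp continuous_neg).mul
        (continuous_logistic.comp (by fun_prop))) fun x => ?_
    rw [abs_mul, abs_of_pos (logistic_pos _)]
    exact mul_le_mul (abs_inv_cosh_le _) (logistic_le _) (logistic_pos _).le zero_le_one
  have h4 : (∫ x, (Real.cosh (s * x))⁻¹ * logistic (s * x) ∂(gaussianReal 0 1)) +
      ∫ x, (Real.cosh (s * -x))⁻¹ * logistic (s * -x) ∂(gaussianReal 0 1) =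
      2 * ∫ x, (Real.cosh (s * x))⁻¹ ∂(gaussianReal 0 1) := by
    rw [← integral_add hint hint', ← integral_const_mul]
    refine integral_congr_ae (ae_of_all _ fun x => ?_)
    simp only [mul_neg, Real.cosh_neg]
    rw [← mul_add, logistic_add_neg, mul_comm]
  linarith

/-- The relation between mutual information and mean square error in a Gaussian channel. With `L =
logistic (s * x + s ^ 2)`, differentiating under the integral gives `-E[(x + 2 s) L]`; integration
by parts gives `E[x L] = -s E[L (2 - L)]`, so only `-s E[L²]` remains. -/
theorem hasDerivAt_errEnt (s : ℝ) : HasDerivAt errEnt (-(s * mmse s)) s := by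
  set F : ℝ → ℝ → ℝ := fun s x => Real.log (1 + Real.exp (-2 * (s * x) - 2 * s ^ 2)) with hF
  set F' : ℝ → ℝ → ℝ := fun s x => -((x + 2 * s) * logistic (s * x + s ^ 2)) with hF'
  have hcont : ∀ s, Continuous (F s) := fun s => continuous_log_one_add_exp (by fun_prop)
  have hderiv : ∀ s x, HasDerivAt (fun s => F s x) (F' s x) s := by
    intro s x
    have h1 : HasDerivAt (fun s : ℝ => -2 * (s * x) - 2 * s ^ 2) (-2 * x - 4 * s) s := by
      have := (((hasDerivAt_id s).mul_const x).const_mul (-2)).sub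
        ((hasDerivAt_pow 2 s).const_mul 2)
      refine this.congr_deriv ?_
      simp
      ring
    have h2 := (h1.exp.const_add 1).log (by positivity)
    refine h2.congr_deriv ?_
    simp only [hF', logistic]
    rw [show -2 * (s * x) - 2 * s ^ 2 = -(2 * (s * x + s ^ 2)) by ring, Real.exp_neg]
    have := Real.exp_pos (2 * (s * x + s ^ 2))
    field_simp
    ring
  have hlc : Continuous fun x => logistic (s * x + s ^ 2) := continuous_logistic.comp (by fun_prop)
  have hint : Integrable (fun x => |x|) (gaussianReal 0 1) := integrable_abs_gaussianReal
  have hmain := (hasDerivAt_integral_of_dominated_loc_of_deriv_le (μ := gaussianReal 0 1)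
    (F := F) (F' := F') (x₀ := s) (s := Metric.ball s 1)
    (bound := fun x => (|x| + 2 * (|s| + 1)) * 2) (Metric.ball_mem_nhds s one_pos)
    (Eventually.of_forall fun s => (hcont s).aestronglyMeasurable)
    (by
      refine (((integrable_exp_mul_gaussianReal (μ := 0) (v := 1) (-2 * s)).mul_const
        (Real.exp (-2 * s ^ 2)))).mono' (hcont s).aestronglyMeasurable (ae_of_all _ fun x => ?_)
      have h1 : 0 ≤ F s x := Real.log_nonneg (by linarith [Real.exp_pos (-2 * (s * x) - 2 * s ^ 2)])
      rw [Real.norm_of_nonneg h1, ← Real.exp_add]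
      have h2 := Real.log_le_sub_one_of_pos
        (show 0 < 1 + Real.exp (-2 * (s * x) - 2 * s ^ 2) by positivity)
      rw [add_sub_cancel_left] at h2
      refine h2.trans (le_of_eq ?_)
      congr 1
      ring)
    (Continuous.aestronglyMeasurable (by simp only [hF']; fun_prop))
    (ae_of_all _ fun x t ht => by
      simp only [hF', norm_neg, norm_mul, Real.norm_eq_abs]
      have h1 : |t| ≤ |s| + 1 := by
        have h2 : |t - s| < 1 := by simpa [Real.dist_eq] using ht
        have h3 := abs_add_le (t - s) s
        rw [sub_add_cancel] at h3
        linarith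
      have h2 : |x + 2 * t| ≤ |x| + 2 * (|s| + 1) := by
        refine (abs_add_le _ _).trans ?_
        rw [abs_mul, abs_two]
        linarith
      rw [abs_of_pos (logistic_pos _)]
      exact mul_le_mul h2 (logistic_le _) (logistic_pos _).le (by positivity))
    ((hint.add (integrable_const _)).mul_const _)
    (ae_of_all _ fun x t _ => hderiv t x)).2
  refine hmain.congr_deriv ?_
  have hxl : Integrable (fun x => x * logistic (s * x + s ^ 2)) (gaussianReal 0 1) := by
    refine (hint.mul_const 2).mono' (Continuous.aestronglyMeasurable (by fun_prop))
      (ae_of_all _ fun x => ?_)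
    rw [norm_mul, Real.norm_eq_abs, Real.norm_of_nonneg (logistic_pos _).le]
    exact mul_le_mul_of_nonneg_left (logistic_le _) (abs_nonneg x)
  have hl : Integrable (fun x => logistic (s * x + s ^ 2)) (gaussianReal 0 1) :=
    integrable_gaussianReal_of_bdd hlc (C := 2) fun x => by
      rw [abs_of_pos (logistic_pos _)]; exact logistic_le _
  have hl2 : Integrable (fun x => logistic (s * x + s ^ 2) ^ 2) (gaussianReal 0 1) :=
    integrable_gaussianReal_of_bdd (hlc.pow 2) (C := 2 ^ 2) fun x => by
      rw [abs_of_pos (by have := logistic_pos (s * x + s ^ 2); positivity)]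
      exact pow_le_pow_left₀ (logistic_pos _).le (logistic_le _) 2
  have hstein := integral_id_mul_gaussianReal (g := fun x => logistic (s * x + s ^ 2))
    (g' := fun x => -s * (logistic (s * x + s ^ 2) * (2 - logistic (s * x + s ^ 2))))
    (fun x => by
      have h1 : HasDerivAt (fun x : ℝ => s * x + s ^ 2) s x := by
        simpa using ((hasDerivAt_id x).const_mul s).add_const (s ^ 2)
      refine ((hasDerivAt_logistic _).comp x h1).congr_deriv ?_
      ring)
    (by fun_prop) (C := 2) (C' := |s| * (2 * 2))
    (fun x => by rw [abs_of_pos (logistic_pos _)]; exact logistic_le _)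
    (fun x => by
      have h2 : 0 ≤ 2 - logistic (s * x + s ^ 2) := by linarith [logistic_le (s * x + s ^ 2)]
      rw [abs_mul, abs_neg, abs_mul, abs_of_pos (logistic_pos _), abs_of_nonneg h2]
      refine mul_le_mul_of_nonneg_left ?_ (abs_nonneg s)
      exact mul_le_mul (logistic_le _) (by linarith [logistic_pos (s * x + s ^ 2)])
        h2 zero_le_two)
  rw [← integral_logistic_sq]
  simp only [hF']
  have e1 : ∫ x, -((x + 2 * s) * logistic (s * x + s ^ 2)) ∂(gaussianReal 0 1) =
      -((∫ x, x * logistic (s * x + s ^ 2) ∂(gaussianReal 0 1)) +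
        2 * s * ∫ x, logistic (s * x + s ^ 2) ∂(gaussianReal 0 1)) := by
    rw [integral_neg, ← integral_const_mul, ← integral_add hxl (hl.const_mul _)]
    congr 2
    ext x
    ring
  have e2 : ∫ x, -s * (logistic (s * x + s ^ 2) * (2 - logistic (s * x + s ^ 2)))
      ∂(gaussianReal 0 1) = -s * (2 * (∫ x, logistic (s * x + s ^ 2) ∂(gaussianReal 0 1)) -
        ∫ x, logistic (s * x + s ^ 2) ^ 2 ∂(gaussianReal 0 1)) := by
    have e3 : ∫ x, logistic (s * x + s ^ 2) * (2 - logistic (s * x + s ^ 2))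
        ∂(gaussianReal 0 1) = 2 * (∫ x, logistic (s * x + s ^ 2) ∂(gaussianReal 0 1)) -
        ∫ x, logistic (s * x + s ^ 2) ^ 2 ∂(gaussianReal 0 1) := by
      rw [← integral_const_mul, ← integral_sub (hl.const_mul _) hl2]
      exact integral_congr_ae (ae_of_all _ fun x => by ring)
    rw [integral_const_mul, e3]
  rw [e1, hstein, e2]
  ring

theorem mmse_nonneg (s : ℝ) : 0 ≤ mmse s :=
  mul_nonneg (Real.exp_pos _).le (integral_nonneg fun _ => (inv_pos.mpr (Real.cosh_pos _)).le)

theorem mmse_anti {s t : ℝ} (hs : 0 ≤ s) (h : s ≤ t) : mmse t ≤ mmse s := by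
  refine mul_le_mul ?_ ?_ (integral_nonneg fun _ => (inv_pos.mpr (Real.cosh_pos _)).le)
    (Real.exp_pos _).le
  · rw [Real.exp_le_exp]
    nlinarith
  · refine integral_mono (integrable_inv_cosh t) (integrable_inv_cosh s) fun x => ?_
    refine inv_anti₀ (Real.cosh_pos _) ?_
    rw [Real.cosh_le_cosh, abs_mul, abs_mul, abs_of_nonneg hs, abs_of_nonneg (hs.trans h)]
    gcongr

theorem antitoneOn_errEnt : AntitoneOn errEnt (Set.Ici 0) := by
  refine antitoneOn_of_deriv_nonpos (convex_Ici 0)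
    (fun s _ => (hasDerivAt_errEnt s).continuousAt.continuousWithinAt)
    (fun s _ => (hasDerivAt_errEnt s).differentiableAt.differentiableWithinAt) fun s hs => ?_
  rw [interior_Ici] at hs
  rw [(hasDerivAt_errEnt s).deriv, neg_nonpos]
  exact mul_nonneg (le_of_lt hs) (mmse_nonneg s)

/-! ### Midpoint quadrature bounding `mmse` from below -/

/-- The unnormalised density `e^{-x²/2} / cosh (s x)`. -/
def sechDensity (s x : ℝ) : ℝ := Real.exp (-x ^ 2 / 2) * (Real.cosh (s * x))⁻¹

theorem sechDensity_pos (s x : ℝ) : 0 < sechDensity s x :=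
  mul_pos (Real.exp_pos _) (inv_pos.mpr (Real.cosh_pos _))

theorem continuous_sechDensity (s : ℝ) : Continuous (sechDensity s) :=
  Continuous.mul (by fun_prop) (continuous_inv_cosh s)

theorem sechDensity_abs (s x : ℝ) : sechDensity s |x| = sechDensity s x := by
  have h : Real.cosh (s * |x|) = Real.cosh (s * x) := by
    rw [← Real.cosh_abs, abs_mul, abs_abs, ← abs_mul, Real.cosh_abs]
  rw [sechDensity, sq_abs, h, sechDensity]

theorem cosh_add_mul_cosh_sub_le (a b : ℝ) :
    Real.cosh (a + b) * Real.cosh (a - b) ≤ (Real.cosh a * Real.cosh b) ^ 2 := by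
  rw [Real.cosh_add, Real.cosh_sub]
  nlinarith [sq_nonneg (Real.sinh a * Real.sinh b)]

/-- AM-GM reduces the sum to a product, and `cosh (a + b) * cosh (a - b) ≤ (cosh a * cosh b) ^ 2`
with `cosh b ≤ exp (b ^ 2 / 2)` bounds the product. No second derivative has to be estimated. -/
theorem le_sechDensity_add_sub (s c y : ℝ) :
    2 * sechDensity s c * (1 - (1 + s ^ 2) * y ^ 2 / 2) ≤
      sechDensity s (c + y) + sechDensity s (c - y) := by
  set a := sechDensity s (c + y) with ha
  set b := sechDensity s (c - y) with hb
  set m := sechDensity s c * Real.exp (-((1 + s ^ 2) * y ^ 2 / 2)) with hm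
  have ha0 : 0 < a := sechDensity_pos _ _
  have hb0 : 0 < b := sechDensity_pos _ _
  have hm0 : 0 < m := mul_pos (sechDensity_pos _ _) (Real.exp_pos _)
  have hprod : m ^ 2 ≤ a * b := by
    have h1 : a * b = Real.exp (-c ^ 2 - y ^ 2) *
        (Real.cosh (s * c + s * y) * Real.cosh (s * c - s * y))⁻¹ := by
      rw [ha, hb, sechDensity, sechDensity, mul_inv, ← mul_add, ← mul_sub,
        show -c ^ 2 - y ^ 2 = -(c + y) ^ 2 / 2 + -(c - y) ^ 2 / 2 by ring, Real.exp_add]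
      ring
    have h2 : m ^ 2 = Real.exp (-c ^ 2 - y ^ 2) *
        ((Real.cosh (s * c) * Real.exp ((s * y) ^ 2 / 2)) ^ 2)⁻¹ := by
      rw [hm, sechDensity, mul_pow, mul_pow, mul_pow, mul_inv, inv_pow, ← Real.exp_nat_mul,
        ← Real.exp_nat_mul, ← Real.exp_nat_mul, ← Real.exp_neg, mul_right_comm, ← Real.exp_add,
        mul_left_comm, ← Real.exp_add, mul_comm]
      congr 2
      push_cast
      ring
    rw [h1, h2]
    refine mul_le_mul_of_nonneg_left (inv_anti₀
      (mul_pos (Real.cosh_pos _) (Real.cosh_pos _)) ?_) (Real.exp_pos _).le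
    refine (cosh_add_mul_cosh_sub_le _ _).trans (pow_le_pow_left₀ ?_ ?_ 2)
    · exact (mul_pos (Real.cosh_pos _) (Real.cosh_pos _)).le
    · exact mul_le_mul_of_nonneg_left (Real.cosh_le_exp_half_sq _) (Real.cosh_pos _).le
  have h3 : 2 * m ≤ a + b := by nlinarith [sq_nonneg (a - b)]
  have h4 : 1 - (1 + s ^ 2) * y ^ 2 / 2 ≤ Real.exp (-((1 + s ^ 2) * y ^ 2 / 2)) := by
    linarith [Real.add_one_le_exp (-((1 + s ^ 2) * y ^ 2 / 2))]
  refine le_trans ?_ h3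
  rw [hm, ← mul_assoc]
  exact mul_le_mul_of_nonneg_left h4 (by have := sechDensity_pos s c; positivity)

theorem le_integral_sechDensity_cell (s c δ : ℝ) (hδ : 0 ≤ δ) :
    2 * sechDensity s c * (δ - (1 + s ^ 2) * δ ^ 3 / 6) ≤
      ∫ x in (c - δ)..(c + δ), sechDensity s x := by
  have hf := continuous_sechDensity s
  have h1 : ∫ x in (c - δ)..(c + δ), sechDensity s x =
      ∫ y in (0 : ℝ)..δ, (sechDensity s (c + y) + sechDensity s (c - y)) := by
    rw [intervalIntegral.integral_add (Continuous.intervalIntegrable (by fun_prop) _ _)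
      (Continuous.intervalIntegrable (by fun_prop) _ _),
      intervalIntegral.integral_comp_add_left, intervalIntegral.integral_comp_sub_left,
      add_zero, sub_zero, add_comm (∫ x in c..c + δ, sechDensity s x),
      intervalIntegral.integral_add_adjacent_intervals (hf.intervalIntegrable _ _)
      (hf.intervalIntegrable _ _)]
  have h2 : ∫ y in (0 : ℝ)..δ, 2 * sechDensity s c * (1 - (1 + s ^ 2) * y ^ 2 / 2) =
      2 * sechDensity s c * (δ - (1 + s ^ 2) * δ ^ 3 / 6) := by
    rw [intervalIntegral.integral_const_mul, intervalIntegral.integral_sub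
      (Continuous.intervalIntegrable (by fun_prop) _ _)
      (Continuous.intervalIntegrable (by fun_prop) _ _), intervalIntegral.integral_div,
      intervalIntegral.integral_const_mul, integral_pow]
    simp
    ring_nf
    simp
  rw [h1, ← h2]
  exact intervalIntegral.integral_mono_on hδ (Continuous.intervalIntegrable (by fun_prop) _ _)
    (Continuous.intervalIntegrable (by fun_prop) _ _) fun y _ => le_sechDensity_add_sub s c y

theorem integrable_sechDensity (s : ℝ) : Integrable (sechDensity s) := by
  have h := (integrable_gaussianReal_iff.mp (integrable_inv_cosh s)).const_mul (√(2 * Real.pi))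
  refine h.congr (ae_of_all _ fun x => ?_)
  have : √(2 * Real.pi) ≠ 0 := by positivity
  simp only [gaussianPDFReal_std, sechDensity]
  field_simp

theorem integral_inv_cosh_eq (s : ℝ) : ∫ x, (Real.cosh (s * x))⁻¹ ∂(gaussianReal 0 1) =
    (√(2 * Real.pi))⁻¹ * (2 * ∫ x in Set.Ioi (0 : ℝ), sechDensity s x) := by
  rw [integral_gaussianReal_std, ← integral_comp_abs, ← integral_const_mul]
  refine integral_congr_ae (ae_of_all _ fun x => ?_)
  simp only [sechDensity_abs]
  rw [gaussianPDFReal_std, sechDensity, mul_assoc]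

/-- The midpoint rule, with its error, as a lower bound. -/
theorem le_integral_inv_cosh (s : ℝ) {h : ℝ} (hh : 0 ≤ h) (N : ℕ) :
    (√(2 * Real.pi))⁻¹ * (2 * h * (1 - (1 + s ^ 2) * h ^ 2 / 24) *
      ∑ k ∈ Finset.range N, sechDensity s ((k + 1 / 2) * h)) ≤
      ∫ x, (Real.cosh (s * x))⁻¹ ∂(gaussianReal 0 1) := by
  have hf := continuous_sechDensity s
  rw [integral_inv_cosh_eq]
  refine mul_le_mul_of_nonneg_left ?_ (by positivity)
  have h1 : ∫ x in (0 : ℝ)..(N * h), sechDensity s x ≤ ∫ x in Set.Ioi (0 : ℝ), sechDensity s x := by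
    rw [intervalIntegral.integral_of_le (by positivity)]
    exact setIntegral_mono_set (integrable_sechDensity s).integrableOn
      (ae_of_all _ fun x => (sechDensity_pos s x).le) Set.Ioc_subset_Ioi_self.eventuallyLE
  have h2 := intervalIntegral.sum_integral_adjacent_intervals (μ := volume) (n := N)
    (a := fun k : ℕ => (k : ℝ) * h) (f := sechDensity s) fun k _ => hf.intervalIntegrable _ _
  simp only [Nat.cast_zero, zero_mul] at h2
  have h3 : h * (1 - (1 + s ^ 2) * h ^ 2 / 24) *
      ∑ k ∈ Finset.range N, sechDensity s ((k + 1 / 2) * h) ≤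
      ∑ k ∈ Finset.range N, ∫ x in ((k : ℝ) * h)..(((k + 1 : ℕ) : ℝ) * h), sechDensity s x := by
    rw [Finset.mul_sum]
    refine Finset.sum_le_sum fun k _ => ?_
    have := le_integral_sechDensity_cell s ((k + 1 / 2) * h) (h / 2) (by positivity)
    rw [show ((k : ℝ) + 1 / 2) * h - h / 2 = k * h by ring,
      show ((k : ℝ) + 1 / 2) * h + h / 2 = ((k + 1 : ℕ) : ℝ) * h by push_cast; ring] at this
    refine le_trans (le_of_eq ?_) this
    ring
  linarith

theorem le_mmse (s : ℝ) {h : ℝ} (hh : 0 ≤ h) (N : ℕ) :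
    Real.exp (-s ^ 2 / 2) * ((√(2 * Real.pi))⁻¹ * (2 * h * (1 - (1 + s ^ 2) * h ^ 2 / 24) *
      ∑ k ∈ Finset.range N, sechDensity s ((k + 1 / 2) * h))) ≤ mmse s :=
  mul_le_mul_of_nonneg_left (le_integral_inv_cosh s hh N) (Real.exp_pos _).le

/-- A rational bound for the exponential; powers of it at small arguments suffice for all the
numerics. -/
theorem exp_le_two_add_div_two_sub {y : ℝ} (h0 : 0 ≤ y) (h2 : y < 2) :
    Real.exp y ≤ (2 + y) / (2 - y) := by
  have hd : 0 < 2 - y := by linarith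
  rw [← Real.le_log_iff_exp_le (by positivity)]
  have h := Real.le_log_one_add_of_nonneg (x := 2 * y / (2 - y)) (by positivity)
  have e1 : 1 + 2 * y / (2 - y) = (2 + y) / (2 - y) := by field_simp; ring
  have e2 : 2 * (2 * y / (2 - y)) / (2 * y / (2 - y) + 2) = y := by field_simp; ring
  rwa [e1, e2] at h

theorem two_sub_div_two_add_le_exp_neg {y : ℝ} (h0 : 0 ≤ y) (h2 : y < 2) :
    (2 - y) / (2 + y) ≤ Real.exp (-y) := by
  rw [Real.exp_neg, ← inv_div]
  exact inv_anti₀ (Real.exp_pos _) (exp_le_two_add_div_two_sub h0 h2)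

theorem cosh_le_of_exp_le {y t : ℝ} (hy : 0 ≤ y) (h : Real.exp y ≤ t) :
    Real.cosh y ≤ (t + t⁻¹) / 2 := by
  have h1 : 1 ≤ Real.exp y := Real.one_le_exp hy
  have ht : 0 < t := by linarith
  rw [Real.cosh_eq, Real.exp_neg]
  have h0 := Real.exp_pos y
  generalize Real.exp y = u at *
  have : t + t⁻¹ - (u + u⁻¹) = (t - u) * (t * u - 1) / (t * u) := by field_simp; ring
  have h2 : 0 ≤ (t - u) * (t * u - 1) / (t * u) := by
    refine div_nonneg (mul_nonneg (by linarith) ?_) (by positivity)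
    nlinarith
  linarith

/-! ### Natural number certificates for gains and losses -/

/-- The sum of `f` over the naturals below `n`, in a form which the kernel evaluates fast. -/
def natSum (f : ℕ → ℕ) (n : ℕ) : ℕ := Nat.rec 0 (fun k r => r + f k) n

theorem natSum_eq (f : ℕ → ℕ) (n : ℕ) : natSum f n = ∑ k ∈ Finset.range n, f k := by
  induction n with
  | zero => rfl
  | succ n ih => rw [Finset.sum_range_succ, ← ih]; rfl

/-- An upper bound for `2 ^ 30 * exp (j / 2000)`. -/
def expApprox (j : ℕ) : ℕ := 2 ^ 30 * 4001 ^ j / 3999 ^ j + 1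

/-- A lower bound for `2 ^ 30 * exp (- n ^ 2 / 200) / cosh y`, if `exp y ≤ a / 2 ^ 30`. -/
def quadTerm (a n : ℕ) : ℕ :=
  2 ^ 30 * 399 ^ (n ^ 2) / 401 ^ (n ^ 2) * (2 * a ^ n * (2 ^ 30) ^ n) /
    (a ^ (2 * n) + (2 ^ 30) ^ (2 * n))

/-- A lower bound for `2 ^ 30` times the midpoint sum at signal strength `j / 200`. -/
def quadSum (j : ℕ) : ℕ := natSum (fun k => quadTerm (expApprox j) (2 * k + 1)) 20

/-- A lower bound for `2 ^ 30 * (2 * i + 1) * mmse ((i + 1) / 200)`. -/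
def gain (i : ℕ) : ℕ :=
  quadSum (i + 1) * (160000 - (i + 1)) ^ (i + 1) * (23960000 - (i + 1) ^ 2) * 1595768 *
    (2 * i + 1) / ((160000 + (i + 1)) ^ (i + 1) * 24000000 * 10 ^ 7)

/-- An upper bound for `2 ^ 30 * (2 * i + 1) * 0.44 / (i / 200) ^ 2`. -/
def loss (i : ℕ) : ℕ := 2 ^ 30 * (2 * i + 1) * 17600 / i ^ 2 + 1

theorem div_le_cast_div_add_one (a : ℕ) {b : ℕ} (hb : 0 < b) :
    (a : ℝ) / b ≤ ((a / b + 1 : ℕ) : ℝ) := by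
  rw [div_le_iff₀ (by positivity)]
  exact_mod_cast ((Nat.div_lt_iff_lt_mul hb).1 (Nat.lt_succ_self (a / b))).le

theorem exp_le_expApprox (j : ℕ) : Real.exp (j / 2000) ≤ expApprox j / 2 ^ 30 := by
  have h1 : Real.exp (j / 2000) ≤ (4001 / 3999 : ℝ) ^ j := by
    have h := exp_le_two_add_div_two_sub (y := 1 / 2000) (by norm_num) (by norm_num)
    rw [div_eq_mul_one_div, Real.exp_nat_mul]
    refine pow_le_pow_left₀ (Real.exp_pos _).le (h.trans (by norm_num)) j
  refine h1.trans ?_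
  rw [le_div_iff₀ (by positivity), expApprox]
  refine le_trans (le_of_eq ?_) (div_le_cast_div_add_one (2 ^ 30 * 4001 ^ j) (by positivity))
  push_cast
  rw [div_pow]
  ring

theorem quadTerm_le {a n : ℕ} {y : ℝ} (hy : 0 ≤ y) (h : Real.exp y ≤ a / 2 ^ 30) :
    (quadTerm a n : ℝ) / 2 ^ 30 ≤
      Real.exp (-(n : ℝ) ^ 2 / 200) * (Real.cosh (n * y))⁻¹ := by
  have ha : 0 < (a : ℝ) := by
    have := (Real.exp_pos y).trans_le h
    by_contra h0
    have : (a : ℝ) / 2 ^ 30 ≤ 0 := div_nonpos_of_nonpos_of_nonneg (not_lt.mp h0) (by positivity)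
    linarith
  have h1 : ((2 ^ 30 * 399 ^ (n ^ 2) / 401 ^ (n ^ 2) : ℕ) : ℝ) ≤
      2 ^ 30 * Real.exp (-(n : ℝ) ^ 2 / 200) := by
    refine Nat.cast_div_le.trans ?_
    simp only [Nat.cast_mul, Nat.cast_pow, Nat.cast_ofNat]
    rw [mul_div_assoc, ← div_pow]
    refine mul_le_mul_of_nonneg_left ?_ (by positivity)
    have h := two_sub_div_two_add_le_exp_neg (y := 1 / 200) (by norm_num) (by norm_num)
    have e : -(n : ℝ) ^ 2 / 200 = (n ^ 2 : ℕ) * (-(1 / 200)) := by push_cast; ring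
    rw [e, Real.exp_nat_mul]
    exact pow_le_pow_left₀ (by norm_num) (le_trans (by norm_num) h) _
  have h2 : ((2 * a ^ n * (2 ^ 30) ^ n : ℕ) : ℝ) / ((a ^ (2 * n) + (2 ^ 30) ^ (2 * n) : ℕ) : ℝ) ≤
      (Real.cosh (n * y))⁻¹ := by
    have h3 := cosh_le_of_exp_le (y := (n : ℝ) * y) (t := ((a : ℝ) / 2 ^ 30) ^ n) (by positivity)
      (by rw [Real.exp_nat_mul]; exact pow_le_pow_left₀ (Real.exp_pos _).le h n)
    refine le_trans (le_of_eq ?_) (inv_anti₀ (Real.cosh_pos _) h3)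
    simp only [Nat.cast_mul, Nat.cast_add, Nat.cast_pow, Nat.cast_ofNat]
    rw [div_pow, mul_comm 2 n, pow_mul, pow_mul]
    have hd : (2 ^ 30 : ℝ) ^ n ≠ 0 := by positivity
    have hu : (a : ℝ) ^ n ≠ 0 := by positivity
    generalize (2 ^ 30 : ℝ) ^ n = d at hd
    generalize (a : ℝ) ^ n = u at hu
    field_simp
  rw [div_le_iff₀ (by positivity), quadTerm]
  refine Nat.cast_div_le.trans ?_
  rw [Nat.cast_mul, mul_div_assoc]
  calc _ ≤ 2 ^ 30 * Real.exp (-(n : ℝ) ^ 2 / 200) * (Real.cosh (n * y))⁻¹ :=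
        mul_le_mul h1 h2 (by positivity) (by positivity)
    _ = _ := by ring

/-- Twenty cells of width `1 / 5`, covering `[0, 4]`. The midpoints are `n / 10` with `n` odd, which
gives the exponents `n ^ 2 / 200` and `n * j / 2000`. -/
theorem quadSum_le (j : ℕ) : (quadSum j : ℝ) / 2 ^ 30 ≤
    ∑ k ∈ Finset.range 20, sechDensity (j / 200) ((k + 1 / 2) * (1 / 5)) := by
  rw [quadSum, natSum_eq, Nat.cast_sum, Finset.sum_div]
  refine Finset.sum_le_sum fun k _ => ?_
  refine (quadTerm_le (by positivity) (exp_le_expApprox j)).trans (le_of_eq ?_)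
  rw [sechDensity]
  push_cast
  congr 2
  · ring_nf
  · congr 1
    ring

theorem inv_sqrt_two_pi_ge : (0.398942 : ℝ) ≤ (√(2 * Real.pi))⁻¹ := by
  rw [le_inv_comm₀ (by norm_num) (by positivity), Real.sqrt_le_iff]
  refine ⟨by norm_num, ?_⟩
  have := Real.pi_lt_d6
  norm_num
  linarith

/-- With `j = i + 1` and step `1 / 5`, the error factor is `(23960000 - j ^ 2) / 24000000`, the
constant `1595768 / 10 ^ 7` is `0.398942 * 2 / 5`, and `exp (-j ^ 2 / 80000)` is bounded by the
`j`-th power of a rational bound. -/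
theorem gain_le {i : ℕ} (hi : i ≤ 335) :
    (gain i : ℝ) ≤ 2 ^ 30 * (2 * i + 1) * mmse (((i + 1 : ℕ) : ℝ) / 200) := by
  set j := i + 1 with hj
  have hj1 : j ≤ 336 := by omega
  have hjr : (j : ℝ) ≤ 336 := by exact_mod_cast hj1
  have hS := quadSum_le j
  have hm := le_mmse ((j : ℝ) / 200) (h := 1 / 5) (by norm_num) 20
  set S : ℝ := ∑ k ∈ Finset.range 20, sechDensity (j / 200) ((k + 1 / 2) * (1 / 5)) with hSdef
  have hE : ((160000 - j) ^ j : ℝ) / (160000 + j) ^ j ≤ Real.exp (-((j : ℝ) / 200) ^ 2 / 2) := by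
    have h := two_sub_div_two_add_le_exp_neg (y := j / 80000) (by positivity) (by linarith)
    have e : -((j : ℝ) / 200) ^ 2 / 2 = j * (-(j / 80000)) := by ring
    rw [e, Real.exp_nat_mul, ← div_pow]
    refine pow_le_pow_left₀ (div_nonneg (by linarith) (by positivity)) (le_trans (le_of_eq ?_) h) _
    field_simp
    ring
  have hq : (0 : ℝ) ≤ 23960000 - j ^ 2 := by nlinarith
  have hmain : ((160000 - j) ^ j : ℝ) / (160000 + j) ^ j * (0.398942 * (2 * (1 / 5) *
      (1 - (1 + ((j : ℝ) / 200) ^ 2) * (1 / 5) ^ 2 / 24) * (quadSum j / 2 ^ 30))) ≤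
      mmse ((j : ℝ) / 200) := by
    refine le_trans ?_ hm
    have e : 1 - (1 + ((j : ℝ) / 200) ^ 2) * (1 / 5) ^ 2 / 24 = (23960000 - j ^ 2) / 24000000 := by
      ring
    rw [e]
    have h160 : (0 : ℝ) ≤ 160000 - j := by linarith
    have := inv_sqrt_two_pi_ge
    gcongr
  rw [gain, ← hj]
  refine Nat.cast_div_le.trans ?_
  have e1 : ((160000 - j : ℕ) : ℝ) = 160000 - j := by
    rw [Nat.cast_sub (by omega)]; norm_num
  have e2 : ((23960000 - j ^ 2 : ℕ) : ℝ) = 23960000 - j ^ 2 := by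
    rw [Nat.cast_sub ((Nat.pow_le_pow_left hj1 2).trans (by norm_num))]; norm_num
  have hpos : (0 : ℝ) ≤ 2 ^ 30 * (2 * i + 1) := by positivity
  refine le_trans (le_of_eq ?_) (mul_le_mul_of_nonneg_left hmain hpos)
  push_cast [e1, e2]
  generalize (160000 - j : ℝ) ^ j = u
  have hv : (160000 + (j : ℝ)) ^ j ≠ 0 := by positivity
  generalize (160000 + j : ℝ) ^ j = v at hv
  field_simp
  ring

theorem le_loss {i : ℕ} (hi : 0 < i) :
    2 ^ 30 * (2 * i + 1) * (0.44 * (200 / i) ^ 2) ≤ (loss i : ℝ) := by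
  refine le_trans (le_of_eq ?_)
    (div_le_cast_div_add_one (2 ^ 30 * (2 * i + 1) * 17600) (by positivity))
  push_cast
  rw [div_pow]
  ring

/-! ### Choosing the signal strength -/

/-- The entropy gain `- errEnt s`, compensated by the target `0.44 * log s`. -/
def gainFun (s : ℝ) : ℝ := -errEnt s - 0.44 * Real.log s

/-- The derivative of `gainFun` with respect to `s ^ 2 / 2` is `mmse s - 0.44 / s ^ 2`. On the cell
`[a, b]` the decreasing `mmse` is replaced by its value at `b`, and `1 / s ^ 2` by its value at `a`.
-/
theorem gainFun_sub_ge {a b x y : ℝ} (ha : 0 < a) (hax : a ≤ x) (hxy : x ≤ y) (hyb : y ≤ b) :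
    (mmse b - 0.44 * (1 / a) ^ 2) * (y ^ 2 - x ^ 2) / 2 ≤ gainFun y - gainFun x := by
  set e := mmse b - 0.44 * (1 / a) ^ 2 with he
  have hd : ∀ s, 0 < s → HasDerivAt (fun s => gainFun s - e * s ^ 2 / 2)
      (s * mmse s - 0.44 * s⁻¹ - e * s) s := by
    intro s hs
    have h1 := ((hasDerivAt_errEnt s).neg.sub ((Real.hasDerivAt_log hs.ne').const_mul 0.44)).sub
      (((hasDerivAt_pow 2 s).const_mul e).div_const 2)
    refine h1.congr_deriv ?_
    simp
    ring
  have hmono : MonotoneOn (fun s => gainFun s - e * s ^ 2 / 2) (Set.Icc a b) := by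
    refine monotoneOn_of_deriv_nonneg (convex_Icc a b)
      (fun s hs => (hd s (ha.trans_le hs.1)).continuousAt.continuousWithinAt)
      (fun s hs => (hd s (ha.trans_le (interior_subset hs).1)).differentiableAt.differentiableWithinAt)
      fun s hs => ?_
    have hs' := interior_subset hs
    have hs0 : 0 < s := ha.trans_le hs'.1
    rw [(hd s hs0).deriv]
    have h1 : mmse b ≤ mmse s := mmse_anti hs0.le hs'.2
    have h2 : s⁻¹ ≤ s * (1 / a) ^ 2 := by
      rw [inv_le_iff_one_le_mul₀ hs0]
      have : 1 ≤ s / a := (one_le_div ha).mpr hs'.1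
      calc (1 : ℝ) ≤ (s / a) ^ 2 := one_le_pow₀ this
        _ = _ := by ring
    have h3 := mul_le_mul_of_nonneg_left h1 hs0.le
    rw [he]
    linarith
  have := hmono ⟨hax, hxy.trans hyb⟩ ⟨hax.trans hxy, hyb⟩ hxy
  simp only at this
  linarith

/-- The denominator comes from `((i + 1) ^ 2 - i ^ 2) / (2 * 200 ^ 2) = (2 * i + 1) / 80000`. On
part of a cell the bound has the sign of `e`, so the worst case is an empty part or the whole cell,
hence the `min 0`. -/
theorem gainFun_cell {i : ℕ} (h0 : 0 < i) (h1 : i ≤ 335) :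
    ((gain i : ℝ) - loss i) / (80000 * 2 ^ 30) ≤
      gainFun (((i + 1 : ℕ) : ℝ) / 200) - gainFun ((i : ℝ) / 200) ∧
    ∀ x y : ℝ, (i : ℝ) / 200 ≤ x → x ≤ y → y ≤ ((i + 1 : ℕ) : ℝ) / 200 →
      min 0 (((gain i : ℝ) - loss i) / (80000 * 2 ^ 30)) ≤ gainFun y - gainFun x := by
  have hi : (0 : ℝ) < (i : ℝ) / 200 := by positivity
  have key := @gainFun_sub_ge ((i : ℝ) / 200) (((i + 1 : ℕ) : ℝ) / 200)
  set e := mmse (((i + 1 : ℕ) : ℝ) / 200) - 0.44 * (1 / ((i : ℝ) / 200)) ^ 2 with he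
  have hle : (i : ℝ) / 200 ≤ ((i + 1 : ℕ) : ℝ) / 200 := by push_cast; linarith
  have hfull : ((gain i : ℝ) - loss i) / (80000 * 2 ^ 30) ≤
      e * ((((i + 1 : ℕ) : ℝ) / 200) ^ 2 - ((i : ℝ) / 200) ^ 2) / 2 := by
    have h2 := gain_le h1
    have h3 := le_loss h0
    have h4 : (gain i : ℝ) - loss i ≤ 2 ^ 30 * (2 * i + 1) * e := by
      rw [he, one_div_div, mul_sub]
      linarith
    rw [div_le_iff₀ (by positivity)]
    refine h4.trans (le_of_eq ?_)
    push_cast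
    ring
  refine ⟨hfull.trans (key hi le_rfl hle le_rfl), fun x y hx hxy hy => ?_⟩
  have h2 := key hi hx hxy hy
  have hx0 : 0 < x := hi.trans_le hx
  rcases le_total 0 e with he0 | he0
  · refine (min_le_left _ _).trans (le_trans ?_ h2)
    have : x ^ 2 ≤ y ^ 2 := pow_le_pow_left₀ hx0.le hxy 2
    exact div_nonneg (mul_nonneg he0 (by linarith)) zero_le_two
  · refine (min_le_right _ _).trans (hfull.trans (le_trans ?_ h2))
    have h3 : y ^ 2 ≤ (((i + 1 : ℕ) : ℝ) / 200) ^ 2 := pow_le_pow_left₀ (hx0.le.trans hxy) hy 2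
    have h4 : ((i : ℝ) / 200) ^ 2 ≤ x ^ 2 := pow_le_pow_left₀ hi.le hx 2
    have := mul_le_mul_of_nonpos_left
      (show y ^ 2 - x ^ 2 ≤ (((i + 1 : ℕ) : ℝ) / 200) ^ 2 - ((i : ℝ) / 200) ^ 2 by linarith) he0
    linarith

/-- The cells of `[0.84, 1.68]`, in the order in which they are accumulated: first upwards from
`0.985`, then downwards. -/
def cellAt (k : ℕ) : ℕ := bif Nat.blt k 139 then 197 + k else 335 - k

/-- The accumulated balance of gains and losses over the first `n` cells, as long as it stays
nonnegative. -/
def balance (n : ℕ) : Option ℕ :=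
  Nat.rec (some 0) (fun k r => r.bind fun a =>
    bif Nat.ble (loss (cellAt k)) (a + gain (cellAt k)) then
      some (a + gain (cellAt k) - loss (cellAt k)) else none) n

/-- All the numerical evidence for `0.44`: 139 cells from `0.985` up to `1.68`, then 29 down to
`0.84`, with every partial balance nonnegative. -/
theorem balance_isSome : (balance 168).isSome = true := by decide +kernel

theorem balance_succ (n : ℕ) : balance (n + 1) = (balance n).bind fun a =>
    bif Nat.ble (loss (cellAt n)) (a + gain (cellAt n)) then
      some (a + gain (cellAt n) - loss (cellAt n)) else none := rfl

theorem balance_spec (n : ℕ) (h : (balance n).isSome = true) : ∃ a : ℕ, balance n = some a ∧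
    (a : ℝ) = ∑ k ∈ Finset.range n, ((gain (cellAt k) : ℝ) - loss (cellAt k)) := by
  induction n with
  | zero => exact ⟨0, rfl, by simp⟩
  | succ n ih =>
    rw [balance_succ] at h ⊢
    cases hb : balance n with
    | none => simp [hb] at h
    | some b =>
      obtain ⟨a, ha, hsum⟩ := ih (by simp [hb])
      obtain rfl : b = a := Option.some.inj (hb.symm.trans ha)
      rw [hb, Option.bind_some] at h
      rw [Option.bind_some]
      cases hc : Nat.ble (loss (cellAt n)) (b + gain (cellAt n)) with
      | false => simp [hc] at h
      | true =>
        refine ⟨b + gain (cellAt n) - loss (cellAt n), by rw [cond_true], ?_⟩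
        rw [Nat.cast_sub (Nat.le_of_ble_eq_true hc), Finset.sum_range_succ, ← hsum]
        push_cast
        ring

theorem balance_isSome_of_le {n m : ℕ} (h : n ≤ m) (hm : (balance m).isSome = true) :
    (balance n).isSome = true := by
  induction m, h using Nat.le_induction with
  | base => exact hm
  | succ m _ ih =>
    refine ih ?_
    rw [balance_succ] at hm
    cases hb : balance m with
    | none => simp [hb] at hm
    | some b => rfl

theorem sum_gain_sub_loss_nonneg {n : ℕ} (h : n ≤ 168) :
    0 ≤ ∑ k ∈ Finset.range n, ((gain (cellAt k) : ℝ) - loss (cellAt k)) := by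
  obtain ⟨a, -, ha⟩ := balance_spec n (balance_isSome_of_le h balance_isSome)
  rw [← ha]
  positivity

theorem cellAt_of_lt {k : ℕ} (h : k < 139) : cellAt k = 197 + k := by
  have : Nat.blt k 139 = true := by rw [Nat.blt_eq]; exact h
  rw [cellAt, this, cond_true]

theorem cellAt_add (m : ℕ) : cellAt (139 + m) = 196 - m := by
  have : Nat.blt (139 + m) 139 = false :=
    Bool.eq_false_iff.mpr (by rw [Ne, Nat.blt_eq]; omega)
  rw [cellAt, this]
  simp only [cond_false]
  omega

theorem sum_le_gainFun_up {n : ℕ} (h : n ≤ 139) :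
    (∑ k ∈ Finset.range n, ((gain (cellAt k) : ℝ) - loss (cellAt k))) / (80000 * 2 ^ 30) ≤
      gainFun (((197 + n : ℕ) : ℝ) / 200) - gainFun (((197 : ℕ) : ℝ) / 200) := by
  induction n with
  | zero => simp
  | succ n ih =>
    rw [Finset.sum_range_succ, add_div, cellAt_of_lt (by omega)]
    have h1 := ih (by omega)
    have h2 := (gainFun_cell (i := 197 + n) (by omega) (by omega)).1
    rw [← add_assoc]
    linarith

theorem sum_le_gainFun_down {m : ℕ} (h : m ≤ 29) :
    (∑ k ∈ Finset.range (139 + m), ((gain (cellAt k) : ℝ) - loss (cellAt k))) / (80000 * 2 ^ 30) ≤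
      gainFun (((336 : ℕ) : ℝ) / 200) - gainFun (((197 - m : ℕ) : ℝ) / 200) := by
  induction m with
  | zero => exact sum_le_gainFun_up le_rfl
  | succ m ih =>
    rw [← add_assoc, Finset.sum_range_succ, add_div, cellAt_add]
    have h1 := ih (by omega)
    have h2 := (gainFun_cell (i := 196 - m) (by omega) (by omega)).1
    rw [show 196 - m + 1 = 197 - m by omega] at h2
    rw [show 197 - (m + 1) = 196 - m by omega]
    linarith

theorem exists_cell {a b : ℕ} (hab : a < b) {x : ℝ} (h1 : (a : ℝ) / 200 ≤ x)
    (h2 : x ≤ (b : ℝ) / 200) :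
    ∃ i, a ≤ i ∧ i < b ∧ (i : ℝ) / 200 ≤ x ∧ x ≤ ((i + 1 : ℕ) : ℝ) / 200 := by
  induction b, hab using Nat.le_induction with
  | base => exact ⟨a, le_rfl, Nat.lt_succ_self a, h1, h2⟩
  | succ b hb ih =>
    rcases le_total x ((b : ℝ) / 200) with h | h
    · obtain ⟨i, hi1, hi2, hi3⟩ := ih h
      exact ⟨i, hi1, by omega, hi3⟩
    · exact ⟨b, by omega, Nat.lt_succ_self b, h, h2⟩

/-- The balance is nonnegative at both ends of the cell containing `y`; by the partial cell bound
this is enough inside it. -/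
theorem gainFun_ge_left {y : ℝ} (h1 : 197 / 200 ≤ y) (h2 : y ≤ 336 / 200) :
    gainFun (197 / 200) ≤ gainFun y := by
  obtain ⟨i, hi1, hi2, hi3, hi4⟩ := exists_cell (a := 197) (b := 336) (by norm_num)
    (by exact_mod_cast h1) (by exact_mod_cast h2)
  obtain ⟨n, rfl⟩ := Nat.exists_eq_add_of_le hi1
  have hc := (gainFun_cell (i := 197 + n) (by omega) (by omega)).2 _ y le_rfl hi3 hi4
  have hu := sum_le_gainFun_up (n := n) (by omega)
  have hp := div_nonneg (sum_gain_sub_loss_nonneg (n := n) (by omega))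
    (show (0 : ℝ) ≤ 80000 * 2 ^ 30 by positivity)
  have hq := div_nonneg (sum_gain_sub_loss_nonneg (n := n + 1) (by omega))
    (show (0 : ℝ) ≤ 80000 * 2 ^ 30 by positivity)
  rw [Finset.sum_range_succ, add_div, cellAt_of_lt (by omega)] at hq
  simp only [Nat.cast_ofNat] at hu
  rcases min_le_iff.mp hc with h | h <;> linarith

theorem gainFun_le_right {x : ℝ} (h1 : 168 / 200 ≤ x) (h2 : x ≤ 197 / 200) :
    gainFun x ≤ gainFun (336 / 200) := by
  obtain ⟨i, hi1, hi2, hi3, hi4⟩ := exists_cell (a := 168) (b := 197) (by norm_num)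
    (by exact_mod_cast h1) (by exact_mod_cast h2)
  obtain ⟨m, hm, rfl⟩ : ∃ m ≤ 28, i = 196 - m := ⟨196 - i, by omega, by omega⟩
  have hc := (gainFun_cell (i := 196 - m) (by omega) (by omega)).2 x _ hi3 hi4 le_rfl
  have hu := sum_le_gainFun_down (m := m) (by omega)
  have hp := div_nonneg (sum_gain_sub_loss_nonneg (n := 139 + m) (by omega))
    (show (0 : ℝ) ≤ 80000 * 2 ^ 30 by positivity)
  have hq := div_nonneg (sum_gain_sub_loss_nonneg (n := 139 + m + 1) (by omega))
    (show (0 : ℝ) ≤ 80000 * 2 ^ 30 by positivity)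
  rw [Finset.sum_range_succ, add_div, cellAt_add] at hq
  rw [show 196 - m + 1 = 197 - m by omega] at hc
  simp only [Nat.cast_ofNat] at hu
  rcases min_le_iff.mp hc with h | h <;> linarith

/-- The optimal choice of the signal strength. -/
theorem exists_errEnt_sub_ge {M : ℝ} (hM : 1 < M) : ∃ s : ℝ, 0 ≤ s ∧
    0.44 * min (Real.log 2) (Real.log M) ≤ errEnt (M⁻¹ * s) - errEnt s := by
  have hM0 : 0 < M := by linarith
  have key : ∀ x y : ℝ, 0 < x → y = M * x → gainFun x ≤ gainFun y →
      0.44 * Real.log M ≤ errEnt (M⁻¹ * y) - errEnt y := by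
    intro x y hx hy h
    have e : M⁻¹ * y = x := by rw [hy, inv_mul_cancel_left₀ hM0.ne']
    have hlog : Real.log y = Real.log M + Real.log x := by
      rw [hy, Real.log_mul hM0.ne' hx.ne']
    rw [e]
    simp only [gainFun, hlog] at h
    linarith
  rcases le_total M 2 with h2 | h2
  · have hmin : min (Real.log 2) (Real.log M) ≤ Real.log M := min_le_right _ _
    -- Windows `[x, M * x]` inside `[0.84, 1.68]`: start at `0.985` as long as the right end stays
    -- below `1.68`, and otherwise end at `1.68`.
    rcases le_total M (336 / 197) with h3 | h3
    · refine ⟨M * (197 / 200), by positivity, le_trans (by linarith) (key (197 / 200) _ (by norm_num)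
        rfl (gainFun_ge_left (by linarith) (by linarith)))⟩
    · have h4 : M * (M⁻¹ * (336 / 200)) = 336 / 200 := mul_inv_cancel_left₀ hM0.ne' _
      refine ⟨336 / 200, by norm_num, le_trans (by linarith) (key (M⁻¹ * (336 / 200)) _ (by positivity)
        h4.symm (gainFun_le_right ?_ ?_))⟩
      · nlinarith
      · nlinarith
  · have hmin : min (Real.log 2) (Real.log M) ≤ Real.log 2 := min_le_left _ _
    have h5 := gainFun_le_right (x := 168 / 200) le_rfl (by norm_num)
    have h6 : Real.log (336 / 200 : ℝ) = Real.log 2 + Real.log (168 / 200) := by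
      rw [← Real.log_mul (by norm_num) (by norm_num)]
      norm_num
    -- For `M ≥ 2` the weaker signal lies below `0.84`, so its error entropy is at least that of the
    -- case `M = 2`.
    have h7 : errEnt (168 / 200) ≤ errEnt (M⁻¹ * (336 / 200)) := by
      refine antitoneOn_errEnt (Set.mem_Ici.mpr (by positivity)) (Set.mem_Ici.mpr (by norm_num)) ?_
      rw [inv_mul_le_iff₀ hM0]
      linarith
    refine ⟨336 / 200, by norm_num, ?_⟩
    simp only [gainFun, h6] at h5
    linarith

/-! ### Conclusion -/

theorem le_entropyRate_of_isAlgebraic {z : ℂ} (hz : IsAlgebraic ℚ z) :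
    0.44 * min 1 (Real.logb 2 (mahler z)) ≤ entropyRate z := by
  by_cases hinj : ∀ n, Function.Injective (signedSum z n)
  · rw [entropyRate_eq_one hinj]
    have := min_le_left (1 : ℝ) (Real.logb 2 (mahler z))
    linarith
  push Not at hinj
  obtain ⟨n₀, hn₀⟩ := hinj
  have hu := isUnit_leadingCoeff_of_not_injective hz hn₀
  rcases le_or_gt (mahler z) 1 with hM | hM
  · have h1 : Real.logb 2 (mahler z) ≤ 0 := by
      rw [le_antisymm hM (one_le_mahler hz), Real.logb_one]
    have := min_le_right (1 : ℝ) (Real.logb 2 (mahler z))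
    linarith [entropyRate_nonneg z]
  · obtain ⟨s, hs, h⟩ := exists_errEnt_sub_ge hM
    have hlog : 0 < Real.log 2 := Real.log_pos one_lt_two
    refine le_trans ?_ (le_entropyRate (entropy_bound_of_mahler hz hu hM hs))
    rw [le_div_iff₀ hlog]
    refine le_trans (le_of_eq ?_) h
    rw [mul_assoc, min_mul_of_nonneg _ _ hlog.le, one_mul, Real.logb, div_mul_cancel₀ _ hlog.ne']

end BernoulliEntropy

end

theorem theorem1p3 :
    ∃ c : ℝ, 0.44 ≤ c ∧ ∀ z : ℂ, IsAlgebraic ℚ z →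
      Tendsto (BernoulliEntropy.normalizedEntropy z) atTop (𝓝 (BernoulliEntropy.entropyRate z)) ∧
      c * min 1 (Real.logb 2 (BernoulliEntropy.mahler z)) ≤ BernoulliEntropy.entropyRate z ∧
      BernoulliEntropy.entropyRate z ≤ min 1 (Real.logb 2 (BernoulliEntropy.mahler z)) :=
  ⟨0.44, le_rfl, fun z hz => ⟨BernoulliEntropy.tendsto_normalizedEntropy z,
    BernoulliEntropy.le_entropyRate_of_isAlgebraic hz, BernoulliEntropy.entropyRate_le_min hz⟩⟩
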